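/- Let $G$ be a locally compact (Hausdorff) group with identity $e$ and let $(\mathcal{B},G,\pi)$ be a saturated Fell bundle over $G$: a Banach bundle $\pi:\mathcal{B}\to G$ with fibers $B_g=\pi^{-1}(g)$ and Hausdorff total space, equipped with a continuous associative multiplication and a continuous involution such that $B_gB_h\subseteq B_{gh}$ with bilinear restriction, $B_g^*\subseteq B_{g^{-1}}$ with antilinear restriction, $(st)^*=t^*s^*$, $s^{**}=s$, $\|st\|\le\|s\|\|t\|$, $\|s^*s\|=\|s\|^2$ and $s^*s\ge 0$ in the C$^*$-algebra $B_e$, and such that $\operatorname{span}(B_gB_h)$ is dense in $B_{gh}$ for all $g,h\in G$. Then every fiber $B_g$, with the left and right actions of $B_e$ given by the multiplication of $\mathcal{B}$ and with the inner products ${}_{B_e}\langle s,t\rangle=st^*$ and $\langle s,t\rangle_{B_e}=s^*t$, is a Morita equivalence $B_e$-bimodule, and the map $$\psi_{\mathcal{B}}:G\to\operatorname{Pic}(B_e),\qquad \psi_{\mathcal{B}}(g)=[B_g],$$ is a (well-defined) group homomorphism. Here $\operatorname{Pic}(B_e)$ is the Picard group of $B_e$: the group of isomorphism classes of Morita equivalence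 $B_e$-bimodules (isomorphisms being bimodule isomorphisms that preserve both inner products) under the internal tensor product over $B_e$. -/

import Mathlib

universe u v w



noncomputable section

open scoped TensorProduct Topology

section Bimodules

attribute [local instance] CStarAlgebra.spectralOrder CStarAlgebra.spectralOrderedRing

/-- The operations of an `A`-`A`-bimodule `V` with two `A`-valued sesquilinear forms:
`lact a x` is `a x`, `ract a x` is `x a`, `linner x y` is the left inner product (linear in `x`,
conjugate linear in `y`) and `rinner x y` is the right inner product (conjugate linear in `x`,
linear in `y`). No laws besides (sesqui)linearity are included. -/
structure BimoduleData (A : Type u) (V : Type v) [NonUnitalCStarAlgebra A] [AddCommGroup V]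
    [Module ℂ V] where
  lact : A →ₗ[ℂ] V →ₗ[ℂ] V
  ract : A →ₗ[ℂ] V →ₗ[ℂ] V
  linner : V →ₗ[ℂ] V →ₗ⋆[ℂ] A
  rinner : V →ₗ⋆[ℂ] V →ₗ[ℂ] A

namespace BimoduleData

variable {A : Type u} [NonUnitalCStarAlgebra A]

/-- `M` is a Morita equivalence `A`-bimodule (imprimitivity bimodule): a bimodule that is a full
left and a full right Hilbert `A`-module, in a norm `‖x‖² = ‖⟨x, x⟩‖` for which it is complete,
such that each action is by adjointable operators for the inner product on the other side and
the two inner products satisfy the imprimitivity relation `⟨x, y⟩ z = x ⟨y, z⟩`. Positivity refers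
to the usual order of the C⋆-algebra `A`. -/
structure IsMorita {M : Type v} [NormedAddCommGroup M] [NormedSpace ℂ M]
    (D : BimoduleData A M) : Prop where
  lact_mul (a b : A) (x : M) : D.lact (a * b) x = D.lact a (D.lact b x)
  ract_mul (a b : A) (x : M) : D.ract (a * b) x = D.ract b (D.ract a x)
  lact_ract (a b : A) (x : M) : D.lact a (D.ract b x) = D.ract b (D.lact a x)
  linner_lact (a : A) (x y : M) : D.linner (D.lact a x) y = a * D.linner x y
  rinner_ract (a : A) (x y : M) : D.rinner x (D.ract a y) = D.rinner x y * a
  star_linner (x y : M) : star (D.linner x y) = D.linner y x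
  star_rinner (x y : M) : star (D.rinner x y) = D.rinner y x
  linner_nonneg (x : M) : 0 ≤ D.linner x x
  rinner_nonneg (x : M) : 0 ≤ D.rinner x x
  linner_ract (a : A) (x y : M) : D.linner (D.ract a x) y = D.linner x (D.ract (star a) y)
  rinner_lact (a : A) (x y : M) : D.rinner (D.lact a x) y = D.rinner x (D.lact (star a) y)
  imprimitivity (x y z : M) : D.lact (D.linner x y) z = D.ract (D.rinner y z) x
  linner_full : (Submodule.span ℂ {a : A | ∃ x y, D.linner x y = a}).topologicalClosure = ⊤
  rinner_full : (Submodule.span ℂ {a : A | ∃ x y, D.rinner x y = a}).topologicalClosure = ⊤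
  norm_sq_linner (x : M) : ‖x‖ ^ 2 = ‖D.linner x x‖
  norm_sq_rinner (x : M) : ‖x‖ ^ 2 = ‖D.rinner x x‖
  complete : CompleteSpace M

/-- The laws of a Morita equivalence bimodule that survive on a dense subspace before separation
and completion; the imprimitivity relation is only required up to null vectors. -/
structure IsPre {V : Type v} [AddCommGroup V] [Module ℂ V] (D : BimoduleData A V) : Prop where
  lact_mul (a b : A) (x : V) : D.lact (a * b) x = D.lact a (D.lact b x)
  ract_mul (a b : A) (x : V) : D.ract (a * b) x = D.ract b (D.ract a x)
  lact_ract (a b : A) (x : V) : D.lact a (D.ract b x) = D.ract b (D.lact a x)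
  linner_lact (a : A) (x y : V) : D.linner (D.lact a x) y = a * D.linner x y
  rinner_ract (a : A) (x y : V) : D.rinner x (D.ract a y) = D.rinner x y * a
  star_linner (x y : V) : star (D.linner x y) = D.linner y x
  star_rinner (x y : V) : star (D.rinner x y) = D.rinner y x
  linner_nonneg (x : V) : 0 ≤ D.linner x x
  rinner_nonneg (x : V) : 0 ≤ D.rinner x x
  linner_ract (a : A) (x y : V) : D.linner (D.ract a x) y = D.linner x (D.ract (star a) y)
  rinner_lact (a : A) (x y : V) : D.rinner (D.lact a x) y = D.rinner x (D.lact (star a) y)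
  imprim_linner (w x y z : V) :
    D.linner (D.lact (D.linner x y) z) w = D.linner (D.ract (D.rinner y z) x) w
  imprim_rinner (w x y z : V) :
    D.rinner w (D.lact (D.linner x y) z) = D.rinner w (D.ract (D.rinner y z) x)
  linner_full : (Submodule.span ℂ {a : A | ∃ x y, D.linner x y = a}).topologicalClosure = ⊤
  rinner_full : (Submodule.span ℂ {a : A | ∃ x y, D.rinner x y = a}).topologicalClosure = ⊤

theorem IsMorita.isPre {M : Type v} [NormedAddCommGroup M] [NormedSpace ℂ M]
    {D : BimoduleData A M} (h : D.IsMorita) : D.IsPre where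
  lact_mul := h.lact_mul
  ract_mul := h.ract_mul
  lact_ract := h.lact_ract
  linner_lact := h.linner_lact
  rinner_ract := h.rinner_ract
  star_linner := h.star_linner
  star_rinner := h.star_rinner
  linner_nonneg := h.linner_nonneg
  rinner_nonneg := h.rinner_nonneg
  linner_ract := h.linner_ract
  rinner_lact := h.rinner_lact
  imprim_linner w x y z := by rw [h.imprimitivity]
  imprim_rinner w x y z := by rw [h.imprimitivity]
  linner_full := h.linner_full
  rinner_full := h.rinner_full

end BimoduleData

/-- The complex conjugate of a complex vector space: the same additive group, on which a scalar
`z` acts as its conjugate did. -/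
def Conj (V : Type v) : Type v := V

instance (V : Type v) [AddCommGroup V] : AddCommGroup (Conj V) := inferInstanceAs (AddCommGroup V)

instance (V : Type v) [AddCommGroup V] [Module ℂ V] : Module ℂ (Conj V) :=
  Module.compHom V (starRingEnd ℂ)

instance (V : Type v) [NormedAddCommGroup V] : NormedAddCommGroup (Conj V) :=
  inferInstanceAs (NormedAddCommGroup V)

instance (V : Type v) [NormedAddCommGroup V] [NormedSpace ℂ V] : NormedSpace ℂ (Conj V) where
  norm_smul_le z x := by
    have h := norm_smul_le (star z) (show V from x)
    rwa [norm_star] at h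

namespace BimoduleData

variable {A : Type u} [NonUnitalCStarAlgebra A]

/-- The conjugate bimodule: `a x̃ = (x a⋆)~`, `x̃ a = (a⋆ x)~`, with the two inner products
interchanged. -/
def conj {V : Type v} [AddCommGroup V] [Module ℂ V] (D : BimoduleData A V) :
    BimoduleData A (Conj V) where
  lact := LinearMap.mk₂ ℂ (fun (a : A) (x : Conj V) => (D.ract (star a) (show V from x) : V))
    (fun a b x => by simp; rfl)
    (fun z a x => by simp; rfl)
    (fun a x y => map_add (D.ract (star a)) (show V from x) (show V from y))
    (fun z a x => map_smul (D.ract (star a)) (star z) (show V from x))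
  ract := LinearMap.mk₂ ℂ (fun (a : A) (x : Conj V) => (D.lact (star a) (show V from x) : V))
    (fun a b x => by simp; rfl)
    (fun z a x => by simp; rfl)
    (fun a x y => map_add (D.lact (star a)) (show V from x) (show V from y))
    (fun z a x => map_smul (D.lact (star a)) (star z) (show V from x))
  linner := LinearMap.mk₂'ₛₗ (RingHom.id ℂ) (starRingEnd ℂ)
    (fun (x y : Conj V) => D.rinner (show V from x) (show V from y))
    (fun x x' y => LinearMap.map_add₂ D.rinner (show V from x) (show V from x') (show V from y))
    (fun z x y => (LinearMap.map_smulₛₗ₂ D.rinner (star z) (show V from x) (show V from y)).trans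
      (by simp))
    (fun x y y' => map_add (D.rinner (show V from x)) (show V from y) (show V from y'))
    (fun z x y => map_smul (D.rinner (show V from x)) (star z) (show V from y))
  rinner := LinearMap.mk₂'ₛₗ (starRingEnd ℂ) (RingHom.id ℂ)
    (fun (x y : Conj V) => D.linner (show V from x) (show V from y))
    (fun x x' y => LinearMap.map_add₂ D.linner (show V from x) (show V from x') (show V from y))
    (fun z x y => LinearMap.map_smul₂ D.linner (star z) (show V from x) (show V from y))
    (fun x y y' => map_add (D.linner (show V from x)) (show V from y) (show V from y'))
    (fun z x y => (LinearMap.map_smulₛₗ (D.linner (show V from x)) (star z)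
      (show V from y)).trans (by simp))

/-- The C⋆-algebra `A` as a bimodule over itself: `⟨x, y⟩ = x y⋆` on the left, `x⋆ y` on the
right. -/
def self (A : Type u) [NonUnitalCStarAlgebra A] : BimoduleData A A where
  lact := LinearMap.mul ℂ A
  ract := (LinearMap.mul ℂ A).flip
  linner := LinearMap.mk₂'ₛₗ (RingHom.id ℂ) (starRingEnd ℂ) (fun x y => x * star y)
    (by intros; simp [add_mul]) (by intros; exact smul_mul_assoc _ _ _)
    (by intros; simp [mul_add])
    (by intros; rw [star_smul]; exact mul_smul_comm _ _ _)
  rinner := LinearMap.mk₂'ₛₗ (starRingEnd ℂ) (RingHom.id ℂ) (fun x y => star x * y)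
    (by intros; simp [add_mul]) (by intros; rw [star_smul]; exact smul_mul_assoc _ _ _)
    (by intros; simp [mul_add]) (by intros; exact mul_smul_comm _ _ _)

/-- The algebraic tensor product of two bimodules, with the actions on the outer factors and the
inner products `⟨m ⊗ n, m' ⊗ n'⟩ = ⟨n, ⟨m, m'⟩ n'⟩` on the right and
`⟨m ⊗ n, m' ⊗ n'⟩ = ⟨m ⟨n, n'⟩, m'⟩` on the left. -/
def tensor {V : Type v} {W : Type w} [AddCommGroup V] [Module ℂ V] [AddCommGroup W] [Module ℂ W]
    (D : BimoduleData A V) (E : BimoduleData A W) : BimoduleData A (V ⊗[ℂ] W) where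
  lact := LinearMap.rTensorHom W ∘ₗ D.lact
  ract := LinearMap.lTensorHom V ∘ₗ E.ract
  linner := TensorProduct.lift (LinearMap.mk₂ ℂ
    (fun m n => TensorProduct.lift (LinearMap.mk₂'ₛₗ (starRingEnd ℂ) (starRingEnd ℂ)
      (fun m' n' => D.linner (D.ract (E.linner n n') m) m')
      (by intros; simp) (by intros; simp) (by intros; simp) (by intros; simp)))
    (by intros; apply TensorProduct.ext'; simp)
    (by intros; apply TensorProduct.ext'; simp)
    (by intros; apply TensorProduct.ext'; simp)
    (by intros; apply TensorProduct.ext'; simp))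
  rinner := TensorProduct.lift (LinearMap.mk₂'ₛₗ (starRingEnd ℂ) (starRingEnd ℂ)
    (fun m n => TensorProduct.lift (LinearMap.mk₂ ℂ
      (fun m' n' => E.rinner n (E.lact (D.rinner m m') n'))
      (by intros; simp) (by intros; simp) (by intros; simp) (by intros; simp)))
    (by intros; apply TensorProduct.ext'; simp)
    (by intros; apply TensorProduct.ext'; simp)
    (by intros; apply TensorProduct.ext'; simp)
    (by intros; apply TensorProduct.ext'; simp))

section apply

variable {V : Type v} {W : Type w} [AddCommGroup V] [Module ℂ V] [AddCommGroup W] [Module ℂ W]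
    (D : BimoduleData A V) (E : BimoduleData A W)

@[simp] theorem tensor_lact (a : A) (m : V) (n : W) :
    (D.tensor E).lact a (m ⊗ₜ n) = D.lact a m ⊗ₜ n := rfl

@[simp] theorem tensor_ract (a : A) (m : V) (n : W) :
    (D.tensor E).ract a (m ⊗ₜ n) = m ⊗ₜ E.ract a n := rfl

@[simp] theorem tensor_linner (m m' : V) (n n' : W) :
    (D.tensor E).linner (m ⊗ₜ n) (m' ⊗ₜ n') = D.linner (D.ract (E.linner n n') m) m' := rfl

@[simp] theorem tensor_rinner (m m' : V) (n n' : W) :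
    (D.tensor E).rinner (m ⊗ₜ n) (m' ⊗ₜ n') = E.rinner n (E.lact (D.rinner m m') n') := rfl

theorem conj_lact (a : A) (x : V) : D.conj.lact a x = D.ract (star a) x := rfl
theorem conj_ract (a : A) (x : V) : D.conj.ract a x = D.lact (star a) x := rfl
theorem conj_linner (x y : V) : D.conj.linner x y = D.rinner x y := rfl
theorem conj_rinner (x y : V) : D.conj.rinner x y = D.linner x y := rfl

@[simp] theorem self_lact (a x : A) : (self A).lact a x = a * x := rfl
@[simp] theorem self_ract (a x : A) : (self A).ract a x = x * a := rfl
@[simp] theorem self_linner (x y : A) : (self A).linner x y = x * star y := rfl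
@[simp] theorem self_rinner (x y : A) : (self A).rinner x y = star x * y := rfl

end apply

section laws

variable {V : Type v} [AddCommGroup V] [Module ℂ V] {D : BimoduleData A V}

theorem IsPre.rinner_ract_left (h : D.IsPre) (a : A) (x y : V) :
    D.rinner (D.ract a x) y = star a * D.rinner x y := by
  rw [← h.star_rinner, h.rinner_ract, star_mul, h.star_rinner]

theorem IsPre.linner_lact_right (h : D.IsPre) (a : A) (x y : V) :
    D.linner x (D.lact a y) = D.linner x y * star a := by
  rw [← h.star_linner, h.linner_lact, star_mul, h.star_linner]

theorem IsPre.conj (h : D.IsPre) : D.conj.IsPre where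
  lact_mul := fun a b (x : V) => by
    change D.ract (star (a * b)) x = D.ract (star a) (D.ract (star b) x)
    rw [star_mul, h.ract_mul]
  ract_mul := fun a b (x : V) => by
    change D.lact (star (a * b)) x = D.lact (star b) (D.lact (star a) x)
    rw [star_mul, h.lact_mul]
  lact_ract := fun a b (x : V) => (h.lact_ract (star b) (star a) x).symm
  linner_lact := fun a (x y : V) => by
    change D.rinner (D.ract (star a) x) y = a * D.rinner x y
    rw [h.rinner_ract_left, star_star]
  rinner_ract := fun a (x y : V) => by
    change D.linner x (D.lact (star a) y) = D.linner x y * a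
    rw [h.linner_lact_right, star_star]
  star_linner := h.star_rinner
  star_rinner := h.star_linner
  linner_nonneg := h.rinner_nonneg
  rinner_nonneg := h.linner_nonneg
  linner_ract := fun a (x y : V) => h.rinner_lact (star a) x y
  rinner_lact := fun a (x y : V) => h.linner_ract (star a) x y
  imprim_linner := fun (w x y z : V) => by
    change D.rinner (D.ract (star (D.rinner x y)) z) w = D.rinner (D.lact (star (D.linner y z)) x) w
    rw [h.star_rinner, h.star_linner, ← h.star_rinner, ← h.imprim_rinner, h.star_rinner]
  imprim_rinner := fun (w x y z : V) => by
    change D.linner w (D.ract (star (D.rinner x y)) z) = D.linner w (D.lact (star (D.linner y z)) x)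
    rw [h.star_rinner, h.star_linner, ← h.star_linner, ← h.imprim_linner, h.star_linner]
  linner_full := h.rinner_full
  rinner_full := h.linner_full

/-- Cauchy-Schwarz for the right inner product. -/
theorem IsPre.norm_rinner_sq_le (h : D.IsPre) (x y : V) :
    ‖D.rinner x y‖ ^ 2 ≤ ‖D.rinner x x‖ * ‖D.rinner y y‖ := by
  set p := D.rinner x x with hp
  set q := D.rinner y y with hq
  set r := D.rinner x y with hr
  have key : ∀ P : ℝ, ‖p‖ < P → ‖r‖ ^ 2 ≤ P * ‖q‖ := by
    intro P hP
    have hP0 : 0 < P := (norm_nonneg p).trans_lt hP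
    have h1 : 0 ≤ star r * p * r - P • (star r * r) - P • (star r * r) + (P * P) • q := by
      have := h.rinner_nonneg (D.ract r x - (P : ℂ) • y)
      have e : D.rinner (D.ract r x - (P : ℂ) • y) (D.ract r x - (P : ℂ) • y) =
          star r * p * r - P • (star r * r) - P • (star r * r) + (P * P) • q := by
        have e1 : D.rinner y x = star r := by rw [hr, h.star_rinner]
        simp only [map_sub, map_smulₛₗ, LinearMap.sub_apply, LinearMap.smul_apply,
          h.rinner_ract, h.rinner_ract_left, e1, ← hp, ← hq, ← hr, Complex.conj_ofReal,
          RingHom.id_apply, mul_smul]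
        simp only [Complex.coe_smul, smul_sub]
        abel
      rwa [e] at this
    have h2 : star r * p * r ≤ ‖p‖ • (star r * r) := by
      apply CStarAlgebra.star_left_conjugate_le_norm_smul
      exact h.star_rinner x x
    have h0 : 0 ≤ star r * r := star_mul_self_nonneg r
    have h3 : ‖p‖ • (star r * r) ≤ P • (star r * r) := smul_le_smul_of_nonneg_right hP.le h0
    have h4 : P • (star r * r) ≤ (P * P) • q := by
      have h5 : star r * p * r - P • (star r * r) ≤ 0 := sub_nonpos.2 (h2.trans h3)
      have h6 : star r * p * r - P • (star r * r) - P • (star r * r) + (P * P) • q ≤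
          0 - P • (star r * r) + (P * P) • q := by gcongr
      have := h1.trans h6
      rw [zero_sub, neg_add_eq_sub, sub_nonneg] at this
      exact this
    have h5 := CStarAlgebra.norm_le_norm_of_nonneg_of_le (smul_nonneg hP0.le h0) h4
    rw [norm_smul, norm_smul, CStarRing.norm_star_mul_self, Real.norm_of_nonneg hP0.le,
      Real.norm_of_nonneg (by positivity), mul_assoc] at h5
    rw [pow_two]
    exact le_of_mul_le_mul_left h5 hP0
  have : Filter.Tendsto (fun P : ℝ => P * ‖q‖) (𝓝[>] ‖p‖) (𝓝 (‖p‖ * ‖q‖)) :=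
    ((continuous_id.mul continuous_const).tendsto _).mono_left nhdsWithin_le_nhds
  exact ge_of_tendsto this (by filter_upwards [self_mem_nhdsWithin] with P hP using key P hP)

theorem IsPre.norm_linner_le_norm_rinner (h : D.IsPre) (x : V) :
    ‖D.linner x x‖ ≤ ‖D.rinner x x‖ := by
  let f₀ : A →ₗ[ℂ] A :=
    { toFun := fun b => D.linner (D.ract b x) x
      map_add' := by intros; simp
      map_smul' := by intros; simp }
  have hpos : ∀ b : A, 0 ≤ b → 0 ≤ f₀ b := by
    intro b hb
    obtain ⟨c, rfl⟩ := CStarAlgebra.nonneg_iff_eq_mul_star_self.1 hb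
    change 0 ≤ D.linner (D.ract (c * star c) x) x
    rw [h.ract_mul, h.linner_ract, star_star]
    exact h.linner_nonneg _
  obtain ⟨C, hC⟩ := PositiveLinearMap.exists_norm_apply_le (PositiveLinearMap.mk₀ f₀ hpos)
  let f : A →L[ℂ] A := f₀.mkContinuous C hC
  have hf : ∀ b, f b = D.linner (D.ract b x) x := fun b => rfl
  have hstar : ∀ b, star (f b) = f (star b) := by
    intro b; rw [hf, hf, h.star_linner, h.linner_ract, star_star]
  have hmul : ∀ b c, f b * f c = f (b * D.rinner x x * c) := by
    intro b c
    rw [hf, hf, hf, ← h.linner_lact, h.imprim_linner, h.rinner_ract, h.ract_mul, h.ract_mul,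
      h.ract_mul]
  have hle : ∀ b, ‖f b‖ ^ 2 ≤ ‖f‖ * ‖D.rinner x x‖ * ‖b‖ ^ 2 := by
    intro b
    rw [pow_two, ← CStarRing.norm_star_mul_self, hstar, hmul]
    calc _ ≤ ‖f‖ * ‖star b * D.rinner x x * b‖ := f.le_opNorm _
      _ ≤ ‖f‖ * (‖star b‖ * ‖D.rinner x x‖ * ‖b‖) := by
        gcongr
        exact (norm_mul_le _ _).trans (by gcongr; exact norm_mul_le _ _)
      _ = _ := by rw [norm_star]; ring
  have hn : ‖f‖ ≤ ‖D.rinner x x‖ := by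
    have h1 : ‖f‖ ≤ √(‖f‖ * ‖D.rinner x x‖) := by
      refine f.opNorm_le_bound (Real.sqrt_nonneg _) fun b => ?_
      rw [← Real.sqrt_sq (norm_nonneg b), ← Real.sqrt_mul (by positivity)]
      exact Real.le_sqrt_of_sq_le (hle b)
    rcases (norm_nonneg f).eq_or_lt with h0 | h0
    · rw [← h0]; exact norm_nonneg _
    · have h2 : ‖f‖ ^ 2 ≤ ‖f‖ * ‖D.rinner x x‖ := by
        rw [← Real.sq_sqrt (show 0 ≤ ‖f‖ * ‖D.rinner x x‖ by positivity)]
        gcongr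
      rw [pow_two] at h2
      exact le_of_mul_le_mul_left h2 h0
  have hL : ‖D.linner x x‖ ^ 2 ≤ ‖D.rinner x x‖ ^ 2 := by
    calc ‖D.linner x x‖ ^ 2 = ‖f (D.rinner x x)‖ := by
          rw [pow_two, ← CStarRing.norm_star_mul_self, h.star_linner, hf, ← h.linner_lact,
            h.imprim_linner]
      _ ≤ ‖f‖ * ‖D.rinner x x‖ := f.le_opNorm _
      _ ≤ _ := by rw [pow_two]; gcongr
  exact (sq_le_sq₀ (norm_nonneg _) (norm_nonneg _)).1 hL

theorem IsPre.norm_linner_eq (h : D.IsPre) (x : V) : ‖D.linner x x‖ = ‖D.rinner x x‖ :=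
  le_antisymm (h.norm_linner_le_norm_rinner x) (h.conj.norm_linner_le_norm_rinner x)

theorem IsPre.norm_rinner_le (h : D.IsPre) (x y : V) :
    ‖D.rinner x y‖ ≤ √‖D.rinner x x‖ * √‖D.rinner y y‖ := by
  rw [← Real.sqrt_mul (norm_nonneg _)]
  exact Real.le_sqrt_of_sq_le (h.norm_rinner_sq_le x y)

theorem IsPre.norm_linner_le (h : D.IsPre) (x y : V) :
    ‖D.linner x y‖ ≤ √‖D.rinner x x‖ * √‖D.rinner y y‖ := by
  rw [← h.norm_linner_eq, ← h.norm_linner_eq]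
  exact h.conj.norm_rinner_le x y

theorem IsPre.norm_ract_le (h : D.IsPre) (a : A) (x : V) :
    √‖D.rinner (D.ract a x) (D.ract a x)‖ ≤ ‖a‖ * √‖D.rinner x x‖ := by
  rw [← Real.sqrt_sq (norm_nonneg a), ← Real.sqrt_mul (by positivity)]
  apply Real.sqrt_le_sqrt
  rw [h.rinner_ract, h.rinner_ract_left]
  calc _ ≤ ‖star a‖ * ‖D.rinner x x‖ * ‖a‖ :=
        (norm_mul_le _ _).trans (by gcongr; exact norm_mul_le _ _)
    _ = _ := by rw [norm_star]; ring

theorem IsPre.norm_lact_le (h : D.IsPre) (a : A) (x : V) :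
    √‖D.rinner (D.lact a x) (D.lact a x)‖ ≤ ‖a‖ * √‖D.rinner x x‖ := by
  have : √‖D.linner (D.lact (star (star a)) x) (D.lact (star (star a)) x)‖ ≤
      ‖star a‖ * √‖D.linner x x‖ := h.conj.norm_ract_le (star a) x
  rwa [h.norm_linner_eq, h.norm_linner_eq, star_star, norm_star] at this

/-- The seminorm `‖x‖ = ‖⟨x, x⟩‖^(1/2)`. -/
theorem IsPre.core (h : D.IsPre) :
    letI : Norm V := ⟨fun x => √‖D.rinner x x‖⟩
    SeminormedSpace.Core ℂ V :=
  letI : Norm V := ⟨fun x => √‖D.rinner x x‖⟩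
  { norm_nonneg := fun x => Real.sqrt_nonneg _
    norm_smul := fun c x => by
      change √‖D.rinner (c • x) (c • x)‖ = ‖c‖ * √‖D.rinner x x‖
      rw [map_smulₛₗ, map_smulₛₗ, LinearMap.smul_apply, norm_smul, norm_smul, RCLike.norm_conj,
        RingHom.id_apply, ← mul_assoc, Real.sqrt_mul (by positivity),
        Real.sqrt_mul_self (norm_nonneg c)]
    norm_triangle := fun x y => by
      change √‖D.rinner (x + y) (x + y)‖ ≤ √‖D.rinner x x‖ + √‖D.rinner y y‖
      refine Real.sqrt_le_iff.2 ⟨by positivity, ?_⟩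
      calc ‖D.rinner (x + y) (x + y)‖
          = ‖(D.rinner x x + D.rinner x y) + (D.rinner y x + D.rinner y y)‖ := by
            simp only [map_add, LinearMap.add_apply]; congr 1; abel
        _ ≤ (‖D.rinner x x‖ + ‖D.rinner x y‖) + (‖D.rinner y x‖ + ‖D.rinner y y‖) :=
            (norm_add_le _ _).trans (add_le_add (norm_add_le _ _) (norm_add_le _ _))
        _ ≤ (√‖D.rinner x x‖ ^ 2 + √‖D.rinner x x‖ * √‖D.rinner y y‖) +
            (√‖D.rinner y y‖ * √‖D.rinner x x‖ + √‖D.rinner y y‖ ^ 2) := by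
            rw [Real.sq_sqrt (norm_nonneg _), Real.sq_sqrt (norm_nonneg _)]
            gcongr
            · exact h.norm_rinner_le x y
            · exact h.norm_rinner_le y x
        _ = _ := by ring }

end laws

end BimoduleData

/-- A Morita equivalence `A`-bimodule, bundled. -/
structure MoritaBimodule (A : Type u) [NonUnitalCStarAlgebra A] where
  carrier : Type u
  [normed : NormedAddCommGroup carrier]
  [space : NormedSpace ℂ carrier]
  data : BimoduleData A carrier
  isMorita : data.IsMorita

attribute [instance] MoritaBimodule.normed MoritaBimodule.space

section extension

variable {V₁ V₂ P₁ P₂ W : Type*} [AddCommGroup V₁] [Module ℂ V₁] [AddCommGroup V₂] [Module ℂ V₂]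
  [NormedAddCommGroup P₁] [NormedSpace ℂ P₁] [NormedAddCommGroup P₂] [NormedSpace ℂ P₂]
  [NormedAddCommGroup W] [NormedSpace ℂ W] [CompleteSpace W] {σ τ : ℂ →+* ℂ}
  [RingHomIsometric τ]

/-- Extension by continuity of a bounded sesquilinear map along maps with dense range. -/
theorem exists_extend_bilinear (φ : V₁ →ₛₗ[σ] V₂ →ₛₗ[τ] W) (e₁ : V₁ →ₗ[ℂ] P₁) (e₂ : V₂ →ₗ[ℂ] P₂)
    (h₁ : DenseRange e₁) (h₂ : DenseRange e₂) (hφ : ∀ x y, ‖φ x y‖ ≤ ‖e₁ x‖ * ‖e₂ y‖) :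
    ∃ Φ : P₁ →SL[σ] P₂ →SL[τ] W, ∀ x y, Φ (e₁ x) (e₂ y) = φ x y := by
  have hb : ∀ x, ∃ C : ℝ, ∀ y, ‖φ x y‖ ≤ C * ‖e₂ y‖ := fun x => ⟨_, hφ x⟩
  have heq : ∀ x y, (φ x).extendOfNorm e₂ (e₂ y) = φ x y := fun x y =>
    LinearMap.extendOfNorm_eq h₂ (hb x) y
  have hext : ∀ (f g : P₂ →SL[τ] W), (∀ y, f (e₂ y) = g (e₂ y)) → f = g := by
    intro f g hfg
    refine ContinuousLinearMap.coeFn_injective (h₂.equalizer f.continuous g.continuous ?_)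
    exact funext hfg
  let ψ : V₁ →ₛₗ[σ] (P₂ →SL[τ] W) :=
    { toFun := fun x => (φ x).extendOfNorm e₂
      map_add' := fun x y => hext _ _ fun z => by
        rw [add_apply, heq, heq, heq, map_add, LinearMap.add_apply]
      map_smul' := fun c x => hext _ _ fun z => by
        rw [smul_apply, heq, heq, map_smulₛₗ, LinearMap.smul_apply] }
  have hψ : ∀ x, ‖ψ x‖ ≤ 1 * ‖e₁ x‖ := fun x => by
    rw [one_mul]
    exact LinearMap.opNorm_extendOfNorm_le h₂ (norm_nonneg _) (hφ x)
  refine ⟨ψ.extendOfNorm e₁, fun x y => ?_⟩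
  rw [LinearMap.extendOfNorm_eq h₁ ⟨1, hψ⟩]
  exact heq x y

/-- A bounded sesquilinear map as a plain sesquilinear map. -/
def unbundleBilinear [RingHomIsometric σ] (Φ : P₁ →SL[σ] P₂ →SL[τ] W) : P₁ →ₛₗ[σ] P₂ →ₛₗ[τ] W :=
  LinearMap.mk₂'ₛₗ σ τ (fun x y => Φ x y) (by intros; simp) (by intros; simp) (by intros; simp)
    (by intros; simp)

end extension

namespace BimoduleData

variable {A : Type u} [NonUnitalCStarAlgebra A]

/-- Extension of bimodule operations to a Banach space in which `V` has dense image. -/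
theorem IsPre.exists_extension {V P : Type u} [AddCommGroup V] [Module ℂ V]
    [NormedAddCommGroup P] [NormedSpace ℂ P] [CompleteSpace P]
    {D : BimoduleData A V} (h : D.IsPre) (e : V →ₗ[ℂ] P) (hd : DenseRange e)
    (hen : ∀ x, ‖e x‖ = √‖D.rinner x x‖) :
    ∃ E : BimoduleData A P, E.IsMorita ∧
      (∀ a x, E.lact a (e x) = e (D.lact a x)) ∧
      (∀ a x, E.ract a (e x) = e (D.ract a x)) ∧
      (∀ x y, E.linner (e x) (e y) = D.linner x y) ∧
      (∀ x y, E.rinner (e x) (e y) = D.rinner x y) := by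
  have hid : DenseRange (LinearMap.id : A →ₗ[ℂ] A) := Function.surjective_id.denseRange
  obtain ⟨la, hla⟩ := exists_extend_bilinear (D.lact.compr₂ e) LinearMap.id e hid hd
    (fun a x => by
      simp only [LinearMap.compr₂_apply, hen, LinearMap.id_apply]; exact h.norm_lact_le a x)
  obtain ⟨ra, hra⟩ := exists_extend_bilinear (D.ract.compr₂ e) LinearMap.id e hid hd
    (fun a x => by
      simp only [LinearMap.compr₂_apply, hen, LinearMap.id_apply]; exact h.norm_ract_le a x)
  obtain ⟨li, hli⟩ := exists_extend_bilinear D.linner e e hd hd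
    (fun x y => by rw [hen, hen]; exact h.norm_linner_le x y)
  obtain ⟨ri, hri⟩ := exists_extend_bilinear D.rinner e e hd hd
    (fun x y => by rw [hen, hen]; exact h.norm_rinner_le x y)
  simp only [LinearMap.compr₂_apply, LinearMap.id_apply] at hla hra
  let E : BimoduleData A P := ⟨unbundleBilinear la, unbundleBilinear ra, unbundleBilinear li,
    unbundleBilinear ri⟩
  have cl : ∀ a, Continuous (E.lact a) := fun a => (la a).continuous
  have cr : ∀ a, Continuous (E.ract a) := fun a => (ra a).continuous
  have cli : Continuous fun p : P × P => E.linner p.1 p.2 := by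
    change Continuous fun p : P × P => li p.1 p.2
    have : IsBoundedBilinearMap ℝ fun p : P × P => li p.1 p.2 :=
      { add_left := by intros; simp
        smul_left := by intros; simp [← Complex.coe_smul]
        add_right := by intros; simp
        smul_right := by intros; simp [← Complex.coe_smul]
        bound := ⟨‖li‖ + 1, by positivity, fun x y => (li.le_opNorm₂ x y).trans (by
          gcongr; simp)⟩ }
    exact this.continuous
  have cri : Continuous fun p : P × P => E.rinner p.1 p.2 := by
    change Continuous fun p : P × P => ri p.1 p.2
    fun_prop
  have cla : Continuous fun p : A × P => E.lact p.1 p.2 := by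
    change Continuous fun p : A × P => la p.1 p.2
    fun_prop
  have cra : Continuous fun p : A × P => E.ract p.1 p.2 := by
    change Continuous fun p : A × P => ra p.1 p.2
    fun_prop
  have hla' : ∀ a x, E.lact a (e x) = e (D.lact a x) := hla
  have hra' : ∀ a x, E.ract a (e x) = e (D.ract a x) := hra
  have hli' : ∀ x y, E.linner (e x) (e y) = D.linner x y := hli
  have hri' : ∀ x y, E.rinner (e x) (e y) = D.rinner x y := hri
  have cli' : ∀ {X : Type u} [TopologicalSpace X] {f g : X → P}, Continuous f → Continuous g →
      Continuous fun x => E.linner (f x) (g x) := fun hf hg => cli.comp (hf.prodMk hg)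
  have cri' : ∀ {X : Type u} [TopologicalSpace X] {f g : X → P}, Continuous f → Continuous g →
      Continuous fun x => E.rinner (f x) (g x) := fun hf hg => cri.comp (hf.prodMk hg)
  have cla' : ∀ {X : Type u} [TopologicalSpace X] {f : X → A} {g : X → P}, Continuous f →
      Continuous g → Continuous fun x => E.lact (f x) (g x) := fun hf hg => cla.comp (hf.prodMk hg)
  have cra' : ∀ {X : Type u} [TopologicalSpace X] {f : X → A} {g : X → P}, Continuous f →
      Continuous g → Continuous fun x => E.ract (f x) (g x) := fun hf hg => cra.comp (hf.prodMk hg)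
  have ind1 : ∀ {p : P → Prop}, IsClosed {x | p x} → (∀ x, p (e x)) → ∀ x, p x := by
    intro p hp hx x
    exact hd.induction_on x hp hx
  have ind2 : ∀ {p : P → P → Prop}, IsClosed {x : P × P | p x.1 x.2} →
      (∀ x y, p (e x) (e y)) → ∀ x y, p x y := by
    intro p hp hx x y
    exact hd.induction_on₂ hp hx x y
  have star_linner : ∀ x y, star (E.linner x y) = E.linner y x :=
    ind2 (isClosed_eq (continuous_star.comp cli) (cli' continuous_snd continuous_fst))
      fun x y => by rw [hli', hli', h.star_linner]
  have star_rinner : ∀ x y, star (E.rinner x y) = E.rinner y x :=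
    ind2 (isClosed_eq (continuous_star.comp cri) (cri' continuous_snd continuous_fst))
      fun x y => by rw [hri', hri', h.star_rinner]
  have nsr : ∀ x, ‖x‖ ^ 2 = ‖E.rinner x x‖ :=
    ind1 (isClosed_eq (by fun_prop) (cri' continuous_id continuous_id).norm) fun x => by
      rw [hri', hen, Real.sq_sqrt (norm_nonneg _)]
  have hM : E.IsMorita :=
    { lact_mul := fun a b => ind1 (isClosed_eq (cl _) ((cl a).comp (cl b))) fun x => by
        simp only [hla', h.lact_mul]
      ract_mul := fun a b => ind1 (isClosed_eq (cr _) ((cr b).comp (cr a))) fun x => by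
        simp only [hra', h.ract_mul]
      lact_ract := fun a b => ind1 (isClosed_eq ((cl a).comp (cr b)) ((cr b).comp (cl a)))
        fun x => by simp only [hra', hla', h.lact_ract]
      linner_lact := fun a => ind2 (isClosed_eq (cli' ((cl a).comp continuous_fst) continuous_snd)
        (continuous_const.mul cli)) fun x y => by simp only [hla', hli', h.linner_lact]
      rinner_ract := fun a => ind2 (isClosed_eq (cri' continuous_fst ((cr a).comp continuous_snd))
        (cri.mul continuous_const)) fun x y => by simp only [hra', hri', h.rinner_ract]
      star_linner := star_linner
      star_rinner := star_rinner
      linner_nonneg := ind1 (isClosed_le continuous_const (cli' continuous_id continuous_id))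
        fun x => by simp only [hli', h.linner_nonneg]
      rinner_nonneg := ind1 (isClosed_le continuous_const (cri' continuous_id continuous_id))
        fun x => by simp only [hri', h.rinner_nonneg]
      linner_ract := fun a => ind2 (isClosed_eq (cli' ((cr a).comp continuous_fst) continuous_snd)
        (cli' continuous_fst ((cr _).comp continuous_snd)))
        fun x y => by simp only [hra', hli', h.linner_ract]
      rinner_lact := fun a => ind2 (isClosed_eq (cri' ((cl a).comp continuous_fst) continuous_snd)
        (cri' continuous_fst ((cl _).comp continuous_snd)))
        fun x y => by simp only [hla', hri', h.rinner_lact]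
      imprimitivity := fun x y z => by
        revert x y
        refine ind2 ?_ fun x y => ?_
        · exact isClosed_eq (cla' cli continuous_const)
            (cra' (cri' continuous_snd continuous_const) continuous_fst)
        revert z
        refine ind1 ?_ fun z => ?_
        · exact isClosed_eq (cl _) (cra' (cri' continuous_const continuous_id) continuous_const)
        rw [hli', hla', hri', hra', ← sub_eq_zero, ← norm_eq_zero, ← map_sub, hen]
        rw [map_sub (D.rinner _), h.imprim_rinner, sub_self, norm_zero, Real.sqrt_zero]
      linner_full := by
        rw [eq_top_iff, ← h.linner_full]
        apply Submodule.topologicalClosure_mono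
        apply Submodule.span_mono
        rintro _ ⟨x, y, rfl⟩
        exact ⟨e x, e y, hli' x y⟩
      rinner_full := by
        rw [eq_top_iff, ← h.rinner_full]
        apply Submodule.topologicalClosure_mono
        apply Submodule.span_mono
        rintro _ ⟨x, y, rfl⟩
        exact ⟨e x, e y, hri' x y⟩
      norm_sq_rinner := nsr
      norm_sq_linner := ind1 (isClosed_eq (by fun_prop) (cli' continuous_id continuous_id).norm)
        fun x => by rw [nsr, hri', hli', h.norm_linner_eq]
      complete := inferInstance }
  exact ⟨E, hM, hla', hra', hli', hri'⟩

/-- The separated completion of a bimodule with Morita type inner products. -/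
theorem IsPre.exists_completion {V : Type u} [AddCommGroup V] [Module ℂ V]
    {D : BimoduleData A V} (h : D.IsPre) :
    ∃ (P : MoritaBimodule A) (e : V →ₗ[ℂ] P.carrier), DenseRange e ∧
      (∀ a x, P.data.lact a (e x) = e (D.lact a x)) ∧
      (∀ a x, P.data.ract a (e x) = e (D.ract a x)) ∧
      (∀ x y, P.data.linner (e x) (e y) = D.linner x y) ∧
      (∀ x y, P.data.rinner (e x) (e y) = D.rinner x y) := by
  let _ : Norm V := ⟨fun x => √‖D.rinner x x‖⟩
  let _ : SeminormedAddCommGroup V := SeminormedAddCommGroup.ofCore h.core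
  let _ : NormedSpace ℂ V := ⟨fun c x => (h.core.norm_smul c x).le⟩
  let e : V →ₗ[ℂ] UniformSpace.Completion V :=
    (UniformSpace.Completion.toComplL : V →L[ℂ] UniformSpace.Completion V).toLinearMap
  have hd : DenseRange e := UniformSpace.Completion.denseRange_coe
  obtain ⟨E, hE, h'⟩ := h.exists_extension e hd fun x => UniformSpace.Completion.norm_coe x
  exact ⟨⟨UniformSpace.Completion V, E, hE⟩, e, hd, h'⟩

theorem cfcₙ_almost_unit (a : A) (ha : 0 ≤ a) (g : ℝ → ℝ) (hgc : Continuous g) (hg0 : g 0 = 0)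
    (k : ℝ → ℝ) (hk : k = fun t => g t * t * g t) :
    a - cfcₙ g a * a * cfcₙ g a * a - a * (cfcₙ g a * a * cfcₙ g a) +
      cfcₙ g a * a * cfcₙ g a * a * (cfcₙ g a * a * cfcₙ g a) =
      cfcₙ (fun t => t - k t * t - t * k t + k t * t * k t) a := by
  have hsa : IsSelfAdjoint a := IsSelfAdjoint.of_nonneg ha
  have hid : cfcₙ (fun t : ℝ => t) a = a := cfcₙ_id' ℝ a
  have hkc : Continuous k := by rw [hk]; fun_prop
  have hk0 : k 0 = 0 := by simp [hk]
  have hic : Continuous fun t : ℝ => t := continuous_id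
  have mulc : ∀ f₁ f₂ : ℝ → ℝ, Continuous f₁ → Continuous f₂ → f₁ 0 = 0 → f₂ 0 = 0 →
      cfcₙ f₁ a * cfcₙ f₂ a = cfcₙ (fun t => f₁ t * f₂ t) a := fun f₁ f₂ h₁ h₂ z₁ z₂ =>
    (cfcₙ_mul f₁ f₂ a h₁.continuousOn z₁ h₂.continuousOn z₂).symm
  have e0 : cfcₙ g a * a = cfcₙ (fun t => g t * t) a := by
    rw [← mulc g (fun t => t) hgc hic hg0 rfl, hid]
  have h1 : cfcₙ g a * a * cfcₙ g a = cfcₙ k a := by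
    rw [e0, mulc _ _ (by fun_prop) hgc (by simp) hg0, hk]
  have e1 : cfcₙ k a * a = cfcₙ (fun t => k t * t) a := by
    rw [← mulc k (fun t => t) hkc hic hk0 rfl, hid]
  have e2 : a * cfcₙ k a = cfcₙ (fun t => t * k t) a := by
    rw [← mulc (fun t => t) k hic hkc rfl hk0, hid]
  have e3 : cfcₙ k a * a * cfcₙ k a = cfcₙ (fun t => k t * t * k t) a := by
    rw [e1, mulc _ _ (by fun_prop) hkc (by simp) hk0]
  rw [h1, e3, e1, e2,
    cfcₙ_add (fun t => t - k t * t - t * k t) (fun t => k t * t * k t) a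
      (Continuous.continuousOn (by fun_prop)) (by simp)
      (Continuous.continuousOn (by fun_prop)) (by simp),
    cfcₙ_sub (fun t => t - k t * t) (fun t => t * k t) a
      (Continuous.continuousOn (by fun_prop)) (by simp)
      (Continuous.continuousOn (by fun_prop)) (by simp),
    cfcₙ_sub (fun t => t) (fun t => k t * t) a hic.continuousOn rfl
      (Continuous.continuousOn (by fun_prop)) (by simp), hid]

/-- For `a ≥ 0` there are self-adjoint `c` for which `h = c a c` is nearly a unit for `a`. -/
theorem exists_almost_unit (a : A) (ha : 0 ≤ a) (ε : ℝ) (hε : 0 < ε) :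
    ∃ c : A, star c = c ∧
      ‖a - c * a * c * a - a * (c * a * c) + c * a * c * a * (c * a * c)‖ ≤ ε := by
  obtain ⟨g, hg⟩ : ∃ g : ℝ → ℝ, g = fun t => √(max t 0) / (max t 0 + ε) := ⟨_, rfl⟩
  have hgc : Continuous g := by
    rw [hg]
    refine Continuous.div (by fun_prop) (by fun_prop) fun t => ?_
    have := le_max_right t 0
    positivity
  have hg0 : g 0 = 0 := by simp [hg]
  obtain ⟨k, hk⟩ : ∃ k : ℝ → ℝ, k = fun t => g t * t * g t := ⟨_, rfl⟩
  have hc : IsSelfAdjoint (cfcₙ g a) := cfcₙ_predicate g a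
  refine ⟨cfcₙ g a, hc, ?_⟩
  rw [cfcₙ_almost_unit a ha g hgc hg0 k hk]
  refine norm_cfcₙ_le fun t ht => ?_
  have ht0 : 0 ≤ t := quasispectrum_nonneg_of_nonneg a ha t ht
  have hkt : k t = (t / (t + ε)) ^ 2 := by
    simp only [hk, hg, max_eq_left ht0]
    rw [div_mul_eq_mul_div, div_mul_div_comm, div_pow]
    congr 1
    · rw [mul_right_comm, Real.mul_self_sqrt ht0]; ring
    · ring
  set s := t / (t + ε) with hs
  have hs0 : 0 ≤ s := by positivity
  have hs1 : s ≤ 1 := by rw [hs, div_le_one (by positivity)]; linarith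
  have hst : (1 - s) * (t + ε) = ε := by rw [hs]; field_simp; ring
  have : t - k t * t - t * k t + k t * t * k t = t * (1 - s ^ 2) ^ 2 := by rw [hkt]; ring
  rw [this, Real.norm_of_nonneg (by positivity)]
  have h3 : t * (1 - s) ^ 2 ≤ ε / 4 := by
    have : t = s * (t + ε) := by rw [hs]; field_simp
    have h5 : t * (1 - s) ^ 2 = s * (1 - s) * ε := by
      calc t * (1 - s) ^ 2 = s * (t + ε) * (1 - s) ^ 2 := by rw [← this]
        _ = s * (1 - s) * ((1 - s) * (t + ε)) := by ring
        _ = _ := by rw [hst]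
    rw [h5]
    nlinarith [sq_nonneg (2 * s - 1)]
  calc t * (1 - s ^ 2) ^ 2 = (t * (1 - s) ^ 2) * (1 + s) ^ 2 := by ring
    _ ≤ (ε / 4) * 4 := by
      refine mul_le_mul h3 (by nlinarith) (by positivity) (by positivity)
    _ = ε := by ring

section morita

variable {M : Type v} [NormedAddCommGroup M] [NormedSpace ℂ M] {D : BimoduleData A M}
variable {N : Type w} [NormedAddCommGroup N] [NormedSpace ℂ N] {E : BimoduleData A N}

theorem IsMorita.norm_eq (h : D.IsMorita) (x : M) : ‖x‖ = √‖D.rinner x x‖ := by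
  rw [← h.norm_sq_rinner, Real.sqrt_sq (norm_nonneg x)]

theorem IsMorita.continuous_lact (h : D.IsMorita) (a : A) : Continuous (D.lact a) :=
  (D.lact a).mkContinuous ‖a‖ (fun x => by
    rw [h.norm_eq, h.norm_eq]; exact h.isPre.norm_lact_le a x) |>.continuous

theorem IsMorita.continuous_lact_left (h : D.IsMorita) (x : M) :
    Continuous fun a => D.lact a x :=
  (D.lact.flip x).mkContinuous ‖x‖ (fun a => by
    rw [mul_comm, LinearMap.flip_apply, h.norm_eq, h.norm_eq]
    exact h.isPre.norm_lact_le a x) |>.continuous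

theorem IsMorita.continuous_rinner (h : D.IsMorita) (x : M) : Continuous (D.rinner x) :=
  (D.rinner x).mkContinuous ‖x‖ (fun y => by
    rw [h.norm_eq, h.norm_eq]; exact h.isPre.norm_rinner_le x y) |>.continuous

theorem IsMorita.continuous_linner (h : D.IsMorita) (y : M) :
    Continuous fun x => D.linner x y :=
  (D.linner.flip y).mkContinuous ‖y‖ (fun x => by
    rw [mul_comm, LinearMap.flip_apply, h.norm_eq, h.norm_eq]
    exact h.isPre.norm_linner_le x y) |>.continuous

theorem IsMorita.eq_zero_of_rinner (h : D.IsMorita) {x : M} (hx : D.rinner x x = 0) : x = 0 := by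
  rw [← norm_eq_zero, h.norm_eq, hx, norm_zero, Real.sqrt_zero]

theorem IsMorita.conj (h : D.IsMorita) : D.conj.IsMorita where
  lact_mul := h.isPre.conj.lact_mul
  ract_mul := h.isPre.conj.ract_mul
  lact_ract := h.isPre.conj.lact_ract
  linner_lact := h.isPre.conj.linner_lact
  rinner_ract := h.isPre.conj.rinner_ract
  star_linner := h.star_rinner
  star_rinner := h.star_linner
  linner_nonneg := h.rinner_nonneg
  rinner_nonneg := h.linner_nonneg
  linner_ract := h.isPre.conj.linner_ract
  rinner_lact := h.isPre.conj.rinner_lact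
  imprimitivity := fun (x y z : M) => by
    change D.ract (star (D.rinner x y)) z = D.lact (star (D.linner y z)) x
    rw [h.star_rinner, h.star_linner, h.imprimitivity]
  linner_full := h.rinner_full
  rinner_full := h.linner_full
  norm_sq_linner := h.norm_sq_rinner
  norm_sq_rinner := h.norm_sq_linner
  complete := h.complete

/-- Finitely many elements of a Morita bimodule have a common approximate unit of the special form
`∑ ⟨w i, w i⟩`. -/
theorem IsMorita.exists_almost_frame (h : D.IsMorita) {ι : Type*} (s : Finset ι) (m : ι → M)
    (ε : ℝ) (hε : 0 < ε) :
    ∃ w : ι → M, ∀ j ∈ s, ‖m j - D.lact (∑ i ∈ s, D.linner (w i) (w i)) (m j)‖ ^ 2 ≤ ε := by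
  set a := ∑ i ∈ s, D.linner (m i) (m i) with ha
  have ha0 : 0 ≤ a := Finset.sum_nonneg fun i _ => h.linner_nonneg _
  obtain ⟨c, hc, hle⟩ := exists_almost_unit a ha0 ε hε
  refine ⟨fun i => D.lact c (m i), fun j hj => ?_⟩
  have hsum : ∑ i ∈ s, D.linner (D.lact c (m i)) (D.lact c (m i)) = c * a * c := by
    simp only [h.linner_lact, h.isPre.linner_lact_right, hc, ha, Finset.mul_sum, Finset.sum_mul,
      mul_assoc]
  simp only [hsum]
  set k := c * a * c with hk
  have hks : star k = k := by
    rw [hk, star_mul, star_mul, hc, (IsSelfAdjoint.of_nonneg ha0).star_eq, mul_assoc]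
  rw [h.norm_sq_linner]
  refine le_trans ?_ hle
  have hL : D.linner (m j - D.lact k (m j)) (m j - D.lact k (m j)) =
      D.linner (m j) (m j) - k * D.linner (m j) (m j) - D.linner (m j) (m j) * k +
        k * D.linner (m j) (m j) * k := by
    simp only [map_sub, LinearMap.sub_apply, h.linner_lact, h.isPre.linner_lact_right, hks,
      mul_assoc]
    abel
  refine CStarAlgebra.norm_le_norm_of_nonneg_of_le (h.linner_nonneg _) ?_
  rw [hL, ← sub_nonneg]
  have hd : 0 ≤ a - D.linner (m j) (m j) :=
    sub_nonneg.2 (Finset.single_le_sum (f := fun i => D.linner (m i) (m i))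
      (fun i _ => h.linner_nonneg _) hj)
  obtain ⟨d, hd⟩ := CStarAlgebra.nonneg_iff_eq_mul_star_self.1 hd
  have he := mul_star_self_nonneg (d - k * d)
  convert he using 1
  have : a = D.linner (m j) (m j) + d * star d := by rw [← hd]; abel
  rw [this]
  simp only [star_sub, star_mul, hks, mul_sub, sub_mul, mul_add, add_mul, mul_assoc]
  abel

theorem IsMorita.gram_nonneg (h : D.IsMorita) (h' : E.IsMorita) {ι : Type*} (s : Finset ι)
    (m : ι → M) (n : ι → N) :
    0 ≤ ∑ i ∈ s, ∑ j ∈ s, E.rinner (n i) (E.lact (D.rinner (m i) (m j)) (n j)) := by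
  choose w hw using fun k : ℕ => h.exists_almost_frame s m (1 / (k + 1 : ℝ)) (by positivity)
  let y : ℕ → ι → M := fun k j => D.lact (∑ i ∈ s, D.linner (w k i) (w k i)) (m j)
  have hy : ∀ j ∈ s, Filter.Tendsto (fun k => y k j) Filter.atTop (𝓝 (m j)) := by
    intro j hj
    rw [tendsto_iff_norm_sub_tendsto_zero]
    have h1 : Filter.Tendsto (fun k : ℕ => √(1 / (k + 1 : ℝ))) Filter.atTop (𝓝 0) := by
      simpa using (tendsto_one_div_add_atTop_nhds_zero_nat (𝕜 := ℝ)).sqrt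
    refine squeeze_zero (fun _ => norm_nonneg _) (fun k => ?_) h1
    rw [norm_sub_rev]
    exact Real.le_sqrt_of_sq_le (hw k j hj)
  have hlim : Filter.Tendsto (fun k => ∑ i ∈ s, ∑ j ∈ s,
      E.rinner (n i) (E.lact (D.rinner (m i) (y k j)) (n j))) Filter.atTop
      (𝓝 (∑ i ∈ s, ∑ j ∈ s, E.rinner (n i) (E.lact (D.rinner (m i) (m j)) (n j)))) := by
    refine tendsto_finsetSum _ fun i _ => tendsto_finsetSum _ fun j hj => ?_
    exact (((h'.continuous_rinner (n i)).comp ((h'.continuous_lact_left (n j)).comp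
      (h.continuous_rinner (m i)))).tendsto (m j)).comp (hy j hj)
  refine ge_of_tendsto' hlim fun k => ?_
  have : ∑ i ∈ s, ∑ j ∈ s, E.rinner (n i) (E.lact (D.rinner (m i) (y k j)) (n j)) =
      ∑ l ∈ s, E.rinner (∑ i ∈ s, E.lact (D.rinner (w k l) (m i)) (n i))
        (∑ j ∈ s, E.lact (D.rinner (w k l) (m j)) (n j)) := by
    have e1 : ∀ i j, E.rinner (n i) (E.lact (D.rinner (m i) (y k j)) (n j)) =
        ∑ l ∈ s, E.rinner (E.lact (D.rinner (w k l) (m i)) (n i))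
          (E.lact (D.rinner (w k l) (m j)) (n j)) := by
      intro i j
      simp only [y, map_sum, LinearMap.sum_apply]
      refine Finset.sum_congr rfl fun l _ => ?_
      rw [h.imprimitivity, h.rinner_ract, h'.lact_mul, h'.rinner_lact, h.star_rinner]
    simp only [e1, map_sum, LinearMap.sum_apply]
    rw [Finset.sum_comm]
    conv_rhs => rw [Finset.sum_comm]
    refine Finset.sum_congr rfl fun j _ => ?_
    rw [Finset.sum_comm]
  rw [this]
  exact Finset.sum_nonneg fun l _ => h'.rinner_nonneg _

end morita

section morita

variable {M : Type v} [NormedAddCommGroup M] [NormedSpace ℂ M] {D : BimoduleData A M}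
variable {N : Type w} [NormedAddCommGroup N] [NormedSpace ℂ N] {E : BimoduleData A N}

theorem IsMorita.exists_tendsto (h : D.IsMorita) (x : M) :
    ∃ a : ℕ → A, Filter.Tendsto (fun k => D.lact (a k) x) Filter.atTop (𝓝 x) := by
  choose w hw using fun k : ℕ => h.exists_almost_frame {()} (fun _ => x) (1 / (k + 1 : ℝ))
    (by positivity)
  refine ⟨fun k => D.linner (w k ()) (w k ()), ?_⟩
  rw [tendsto_iff_norm_sub_tendsto_zero]
  have h1 : Filter.Tendsto (fun k : ℕ => √(1 / (k + 1 : ℝ))) Filter.atTop (𝓝 0) := by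
    simpa using (tendsto_one_div_add_atTop_nhds_zero_nat (𝕜 := ℝ)).sqrt
  refine squeeze_zero (fun _ => norm_nonneg _) (fun k => ?_) h1
  rw [norm_sub_rev]
  simpa using Real.le_sqrt_of_sq_le (hw k () (by simp))

theorem IsMorita.tensor_full (h : D.IsMorita) (h' : E.IsMorita) :
    (Submodule.span ℂ {a : A | ∃ m m' n n', E.rinner n (E.lact (D.rinner m m') n') = a}
      ).topologicalClosure = ⊤ := by
  set S := Submodule.span ℂ {a : A | ∃ m m' n n', E.rinner n (E.lact (D.rinner m m') n') = a}
  have hcl : IsClosed (S.topologicalClosure : Set A) := S.isClosed_topologicalClosure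
  have h1 : ∀ n n' a, E.rinner n (E.lact a n') ∈ S.topologicalClosure := by
    intro n n' a
    let f : A →ₗ[ℂ] A := (E.rinner n) ∘ₗ (E.lact.flip n')
    have hf : Continuous f := (h'.continuous_rinner n).comp (h'.continuous_lact_left n')
    have ha : a ∈ (Submodule.span ℂ {a : A | ∃ x y, D.rinner x y = a}).topologicalClosure := by
      rw [h.rinner_full]; trivial
    have : (Submodule.span ℂ {a : A | ∃ x y, D.rinner x y = a}).topologicalClosure ≤
        S.topologicalClosure.comap f := by
      refine Submodule.topologicalClosure_minimal _ ?_ (hcl.preimage hf)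
      rw [Submodule.span_le]
      rintro _ ⟨x, y, rfl⟩
      exact S.le_topologicalClosure (Submodule.subset_span ⟨x, y, n, n', rfl⟩)
    exact this ha
  rw [eq_top_iff, ← h'.rinner_full]
  refine Submodule.topologicalClosure_minimal _ ?_ hcl
  rw [Submodule.span_le]
  rintro _ ⟨n, n', rfl⟩
  obtain ⟨a, ha⟩ := h'.exists_tendsto n'
  exact hcl.mem_of_tendsto (((h'.continuous_rinner n).tendsto _).comp ha)
    (Filter.Eventually.of_forall fun k => h1 n n' (a k))

theorem IsMorita.tensor_isPre (h : D.IsMorita) (h' : E.IsMorita) : (D.tensor E).IsPre where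
  lact_mul a b x := by
    induction x with
    | zero => simp
    | add x y hx hy => simp only [map_add, hx, hy]
    | tmul m n => simp [h.lact_mul]
  ract_mul a b x := by
    induction x with
    | zero => simp
    | add x y hx hy => simp only [map_add, hx, hy]
    | tmul m n => simp [h'.ract_mul]
  lact_ract a b x := by
    induction x with
    | zero => simp
    | add x y hx hy => simp only [map_add, hx, hy]
    | tmul m n => simp
  linner_lact a x y := by
    induction x with
    | zero => simp
    | add x y hx hy => simp only [map_add, LinearMap.add_apply, mul_add, hx, hy]
    | tmul m n =>
      induction y with
      | zero => simp
      | add x y hx hy => simp only [map_add, mul_add, hx, hy]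
      | tmul m' n' => simp [← h.lact_ract, h.linner_lact]
  rinner_ract a x y := by
    induction x with
    | zero => simp
    | add x y hx hy => simp only [map_add, LinearMap.add_apply, add_mul, hx, hy]
    | tmul m n =>
      induction y with
      | zero => simp
      | add x y hx hy => simp only [map_add, add_mul, hx, hy]
      | tmul m' n' => simp [h'.lact_ract, h'.rinner_ract]
  star_linner x y := by
    induction x with
    | zero => simp
    | add x y hx hy => simp only [map_add, LinearMap.add_apply, star_add, hx, hy]
    | tmul m n =>
      induction y with
      | zero => simp
      | add x y hx hy => simp only [map_add, LinearMap.add_apply, star_add, hx, hy]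
      | tmul m' n' => simp [h.star_linner, h.linner_ract, h'.star_linner]
  star_rinner x y := by
    induction x with
    | zero => simp
    | add x y hx hy => simp only [map_add, LinearMap.add_apply, star_add, hx, hy]
    | tmul m n =>
      induction y with
      | zero => simp
      | add x y hx hy => simp only [map_add, LinearMap.add_apply, star_add, hx, hy]
      | tmul m' n' => simp [h'.star_rinner, h'.rinner_lact, h.star_rinner]
  linner_nonneg x := by
    obtain ⟨S, rfl⟩ := TensorProduct.exists_finset x
    have := h'.conj.gram_nonneg h.conj S (fun p => p.2) (fun p => p.1)
    convert this using 1
    simp only [map_sum, LinearMap.sum_apply, tensor_linner]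
    rw [Finset.sum_comm]
    refine Finset.sum_congr rfl fun i _ => Finset.sum_congr rfl fun j _ => ?_
    change _ = D.linner i.1 (D.ract (star (E.linner i.2 j.2)) j.1)
    rw [h.linner_ract]
  rinner_nonneg x := by
    obtain ⟨S, rfl⟩ := TensorProduct.exists_finset x
    have := h.gram_nonneg h' S (fun p => p.1) (fun p => p.2)
    convert this using 1
    simp only [map_sum, LinearMap.sum_apply, tensor_rinner]
    rw [Finset.sum_comm]
  linner_ract a x y := by
    induction x with
    | zero => simp
    | add x y hx hy => simp only [map_add, LinearMap.add_apply, hx, hy]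
    | tmul m n =>
      induction y with
      | zero => simp
      | add x y hx hy => simp only [map_add, hx, hy]
      | tmul m' n' => simp [h'.linner_ract]
  rinner_lact a x y := by
    induction x with
    | zero => simp
    | add x y hx hy => simp only [map_add, LinearMap.add_apply, hx, hy]
    | tmul m n =>
      induction y with
      | zero => simp
      | add x y hx hy => simp only [map_add, hx, hy]
      | tmul m' n' => simp [h.rinner_lact]
  imprim_linner w x y z := by
    induction w with
    | zero => simp
    | add w w' hw hw' => simp only [map_add, hw, hw']
    | tmul m₀ n₀ =>
    induction x with
    | zero => simp
    | add w w' hw hw' => simp only [map_add, LinearMap.add_apply, hw, hw']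
    | tmul m n =>
    induction y with
    | zero => simp
    | add w w' hw hw' => simp only [map_add, LinearMap.add_apply, hw, hw']
    | tmul m' n' =>
    induction z with
    | zero => simp
    | add w w' hw hw' => simp only [map_add, LinearMap.add_apply, hw, hw']
    | tmul m'' n'' =>
      simp only [tensor_lact, tensor_ract, tensor_linner, tensor_rinner, h.imprimitivity,
        ← h'.imprimitivity, h'.linner_lact, h.ract_mul]
  imprim_rinner w x y z := by
    induction w with
    | zero => simp
    | add w w' hw hw' => simp only [map_add, LinearMap.add_apply, hw, hw']
    | tmul m₀ n₀ =>
    induction x with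
    | zero => simp
    | add w w' hw hw' => simp only [map_add, LinearMap.add_apply, hw, hw']
    | tmul m n =>
    induction y with
    | zero => simp
    | add w w' hw hw' => simp only [map_add, LinearMap.add_apply, hw, hw']
    | tmul m' n' =>
    induction z with
    | zero => simp
    | add w w' hw hw' => simp only [map_add, LinearMap.add_apply, hw, hw']
    | tmul m'' n'' =>
      simp only [tensor_lact, tensor_ract, tensor_linner, tensor_rinner, h.imprimitivity,
        ← h'.imprimitivity, h.rinner_ract, h'.lact_mul]
  linner_full := by
    rw [eq_top_iff, ← h'.conj.tensor_full h.conj]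
    apply Submodule.topologicalClosure_mono
    apply Submodule.span_mono
    rintro _ ⟨(n : N), (n' : N), (m : M), (m' : M), rfl⟩
    refine ⟨m ⊗ₜ n, m' ⊗ₜ n', ?_⟩
    change D.linner (D.ract (E.linner n n') m) m' = D.linner m (D.ract (star (E.linner n n')) m')
    rw [h.linner_ract]
  rinner_full := by
    rw [eq_top_iff, ← h.tensor_full h']
    apply Submodule.topologicalClosure_mono
    apply Submodule.span_mono
    rintro _ ⟨m, m', n, n', rfl⟩
    exact ⟨m ⊗ₜ n, m' ⊗ₜ n', rfl⟩

theorem isMorita_self : (self A).IsMorita where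
  lact_mul a b x := mul_assoc a b x
  ract_mul a b x := (mul_assoc x a b).symm
  lact_ract a b x := (mul_assoc a x b).symm
  linner_lact a x y := mul_assoc a x (star y)
  rinner_ract a x y := (mul_assoc (star x) y a).symm
  star_linner x y := by simp
  star_rinner x y := by simp
  linner_nonneg x := mul_star_self_nonneg x
  rinner_nonneg x := star_mul_self_nonneg x
  linner_ract a x y := by simp [mul_assoc]
  rinner_lact a x y := by simp [mul_assoc]
  imprimitivity x y z := by simp [mul_assoc]
  linner_full := by
    rw [eq_top_iff, ← CStarAlgebra.span_nonneg (A := A)]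
    refine le_trans (Submodule.span_mono ?_) (Submodule.le_topologicalClosure _)
    intro a ha
    obtain ⟨c, rfl⟩ := CStarAlgebra.nonneg_iff_eq_mul_star_self.1 (show 0 ≤ a from ha)
    exact ⟨c, c, rfl⟩
  rinner_full := by
    rw [eq_top_iff, ← CStarAlgebra.span_nonneg (A := A)]
    refine le_trans (Submodule.span_mono ?_) (Submodule.le_topologicalClosure _)
    intro a ha
    obtain ⟨c, rfl⟩ := CStarAlgebra.nonneg_iff_eq_star_mul_self.1 (show 0 ≤ a from ha)
    exact ⟨c, c, rfl⟩
  norm_sq_linner x := by rw [self_linner, CStarRing.norm_self_mul_star, pow_two]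
  norm_sq_rinner x := by rw [self_rinner, CStarRing.norm_star_mul_self, pow_two]
  complete := inferInstance

end morita

end BimoduleData

namespace MoritaBimodule

variable {A : Type u} [NonUnitalCStarAlgebra A]

/-- `P` and `Q` are isomorphic as Morita equivalence bimodules: there is a linear bijection that
respects both actions and both inner products. -/
def Equivalent (P Q : MoritaBimodule A) : Prop :=
  ∃ U : P.carrier ≃ₗ[ℂ] Q.carrier,
    (∀ a x, U (P.data.lact a x) = Q.data.lact a (U x)) ∧
    (∀ a x, U (P.data.ract a x) = Q.data.ract a (U x)) ∧
    (∀ x y, Q.data.linner (U x) (U y) = P.data.linner x y) ∧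
    (∀ x y, Q.data.rinner (U x) (U y) = P.data.rinner x y)

/-- The trivial bimodule `A`. -/
def one (A : Type u) [NonUnitalCStarAlgebra A] : MoritaBimodule A :=
  ⟨A, BimoduleData.self A, BimoduleData.isMorita_self⟩

/-- The dual (conjugate) bimodule. -/
def inv (P : MoritaBimodule A) : MoritaBimodule A := ⟨Conj P.carrier, P.data.conj, P.isMorita.conj⟩

/-- The internal tensor product `P ⊗_A Q`: the separated completion of the algebraic tensor product
for its `A`-valued inner products. -/
def tensor (P Q : MoritaBimodule A) : MoritaBimodule A :=
  (P.isMorita.tensor_isPre Q.isMorita).exists_completion.choose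

/-- The image of `x ⊗ y` in the internal tensor product. -/
def tmul (P Q : MoritaBimodule A) :
    P.carrier →ₗ[ℂ] Q.carrier →ₗ[ℂ] (P.tensor Q).carrier :=
  (TensorProduct.mk ℂ P.carrier Q.carrier).compr₂
    (P.isMorita.tensor_isPre Q.isMorita).exists_completion.choose_spec.choose

theorem tmul_lact (P Q : MoritaBimodule A) (a : A) (x : P.carrier) (y : Q.carrier) :
    (P.tensor Q).data.lact a (P.tmul Q x y) = P.tmul Q (P.data.lact a x) y :=
  (P.isMorita.tensor_isPre Q.isMorita).exists_completion.choose_spec.choose_spec.2.1 a (x ⊗ₜ y)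

theorem tmul_ract (P Q : MoritaBimodule A) (a : A) (x : P.carrier) (y : Q.carrier) :
    (P.tensor Q).data.ract a (P.tmul Q x y) = P.tmul Q x (Q.data.ract a y) :=
  (P.isMorita.tensor_isPre Q.isMorita).exists_completion.choose_spec.choose_spec.2.2.1 a (x ⊗ₜ y)

theorem tmul_linner (P Q : MoritaBimodule A) (x x' : P.carrier) (y y' : Q.carrier) :
    (P.tensor Q).data.linner (P.tmul Q x y) (P.tmul Q x' y') =
      P.data.linner (P.data.ract (Q.data.linner y y') x) x' :=
  (P.isMorita.tensor_isPre Q.isMorita).exists_completion.choose_spec.choose_spec.2.2.2.1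
    (x ⊗ₜ y) (x' ⊗ₜ y')

theorem tmul_rinner (P Q : MoritaBimodule A) (x x' : P.carrier) (y y' : Q.carrier) :
    (P.tensor Q).data.rinner (P.tmul Q x y) (P.tmul Q x' y') =
      Q.data.rinner y (Q.data.lact (P.data.rinner x x') y') :=
  (P.isMorita.tensor_isPre Q.isMorita).exists_completion.choose_spec.choose_spec.2.2.2.2
    (x ⊗ₜ y) (x' ⊗ₜ y')

/-- A closed subspace of the internal tensor product that contains all `x ⊗ y` is everything. -/
theorem eq_top_of_tmul_mem (P Q : MoritaBimodule A) (S : Submodule ℂ (P.tensor Q).carrier)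
    (hS : IsClosed (S : Set (P.tensor Q).carrier)) (h : ∀ x y, P.tmul Q x y ∈ S) : S = ⊤ := by
  have hd := (P.isMorita.tensor_isPre Q.isMorita).exists_completion.choose_spec.choose_spec.1
  rw [eq_top_iff]
  rintro z -
  refine hd.induction_on (p := fun z => z ∈ S) z hS fun t => ?_
  induction t with
  | zero => rw [map_zero]; exact S.zero_mem
  | add x y hx hy => rw [map_add]; exact S.add_mem hx hy
  | tmul x y => exact h x y

theorem norm_tmul_le (P Q : MoritaBimodule A) (x : P.carrier) (y : Q.carrier) :
    ‖P.tmul Q x y‖ ≤ ‖x‖ * ‖y‖ := by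
  refine le_of_sq_le_sq ?_ (by positivity)
  rw [(P.tensor Q).isMorita.norm_sq_rinner, tmul_rinner]
  calc _ ≤ ‖y‖ * ‖Q.data.lact (P.data.rinner x x) y‖ := by
        rw [Q.isMorita.norm_eq, Q.isMorita.norm_eq]
        exact Q.isMorita.isPre.norm_rinner_le _ _
    _ ≤ ‖y‖ * (‖P.data.rinner x x‖ * ‖y‖) := by
        gcongr
        rw [Q.isMorita.norm_eq, Q.isMorita.norm_eq]
        exact Q.isMorita.isPre.norm_lact_le _ _
    _ = _ := by rw [← P.isMorita.norm_sq_rinner]; ring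

theorem continuous_tmul_left (P Q : MoritaBimodule A) (y : Q.carrier) :
    Continuous fun x => P.tmul Q x y :=
  ((P.tmul Q).flip y).mkContinuous ‖y‖ (fun x => by
    rw [mul_comm]; exact P.norm_tmul_le Q x y) |>.continuous

theorem continuous_tmul_right (P Q : MoritaBimodule A) (x : P.carrier) :
    Continuous fun y => P.tmul Q x y :=
  (P.tmul Q x).mkContinuous ‖x‖ (P.norm_tmul_le Q x) |>.continuous

/-- Two Morita bimodules with topologically generating families that have the same inner products
are isomorphic. -/
theorem equivalent_of_generators {P Q : MoritaBimodule A} {ι : Type*} (f : ι → P.carrier)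
    (g : ι → Q.carrier) (hf : (Submodule.span ℂ (Set.range f)).topologicalClosure = ⊤)
    (hg : (Submodule.span ℂ (Set.range g)).topologicalClosure = ⊤)
    (hl : ∀ i j, Q.data.linner (g i) (g j) = P.data.linner (f i) (f j))
    (hr : ∀ i j, Q.data.rinner (g i) (g j) = P.data.rinner (f i) (f j)) : P.Equivalent Q := by
  have : CompleteSpace P.carrier := P.isMorita.complete
  have : CompleteSpace Q.carrier := Q.isMorita.complete
  let e₁ := Finsupp.linearCombination ℂ f
  let e₂ := Finsupp.linearCombination ℂ g
  have hd₁ : DenseRange e₁ := by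
    rw [DenseRange, ← LinearMap.coe_range, Finsupp.range_linearCombination,
      ← Submodule.dense_iff_topologicalClosure_eq_top] at *
    exact hf
  have hd₂ : DenseRange e₂ := by
    rw [DenseRange, ← LinearMap.coe_range, Finsupp.range_linearCombination]
    exact (Submodule.dense_iff_topologicalClosure_eq_top).2 hg
  have hR : ∀ c d, Q.data.rinner (e₂ c) (e₂ d) = P.data.rinner (e₁ c) (e₁ d) := by
    intro c d
    simp only [e₁, e₂, Finsupp.linearCombination_apply, Finsupp.sum, map_sum, LinearMap.sum_apply,
      map_smulₛₗ, LinearMap.smul_apply, hr]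
  have hL : ∀ c d, Q.data.linner (e₂ c) (e₂ d) = P.data.linner (e₁ c) (e₁ d) := by
    intro c d
    simp only [e₁, e₂, Finsupp.linearCombination_apply, Finsupp.sum, map_sum, LinearMap.sum_apply,
      map_smulₛₗ, LinearMap.smul_apply, hl]
  have hn : ∀ c, ‖e₂ (LinearEquiv.refl ℂ _ c)‖ = ‖e₁ c‖ := fun c => by
    rw [LinearEquiv.refl_apply, Q.isMorita.norm_eq, P.isMorita.norm_eq, hR]
  let U := (LinearEquiv.refl ℂ (ι →₀ ℂ)).extendOfIsometry e₁ e₂ hd₁ hd₂ hn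
  have hU : ∀ c, U (e₁ c) = e₂ c := fun c => LinearEquiv.extendOfIsometry_eq _ _ _ hd₁ hd₂ hn c
  have cl : ∀ (T : MoritaBimodule A) (x : T.carrier), Continuous fun y => T.data.linner x y := by
    intro T x
    have := (T.isMorita.continuous_linner x).star
    simpa only [T.isMorita.star_linner] using this
  have cr : ∀ (T : MoritaBimodule A) (y : T.carrier), Continuous fun x => T.data.rinner x y := by
    intro T y
    have := (T.isMorita.continuous_rinner y).star
    simpa only [T.isMorita.star_rinner] using this
  have UL : ∀ x y, Q.data.linner (U x) (U y) = P.data.linner x y := by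
    intro x y
    refine hd₁.induction_on x (isClosed_eq ((Q.isMorita.continuous_linner _).comp U.continuous)
      (P.isMorita.continuous_linner _)) fun c => ?_
    refine hd₁.induction_on y (isClosed_eq ((cl Q _).comp U.continuous) (cl P _)) fun d => ?_
    rw [hU, hU, hL]
  have UR : ∀ x y, Q.data.rinner (U x) (U y) = P.data.rinner x y := by
    intro x y
    refine hd₁.induction_on x (isClosed_eq ((cr Q _).comp U.continuous) (cr P _)) fun c => ?_
    refine hd₁.induction_on y (isClosed_eq ((Q.isMorita.continuous_rinner _).comp U.continuous)
      (P.isMorita.continuous_rinner _)) fun d => ?_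
    rw [hU, hU, hR]
  refine ⟨U.toLinearEquiv, fun a x => ?_, fun a x => ?_, UL, UR⟩
  · rw [← sub_eq_zero]
    apply Q.isMorita.conj.eq_zero_of_rinner
    change Q.data.linner (U (P.data.lact a x) - Q.data.lact a (U x))
      (U (P.data.lact a x) - Q.data.lact a (U x)) = 0
    obtain ⟨z, hz⟩ := U.surjective (U (P.data.lact a x) - Q.data.lact a (U x))
    rw [LinearMap.map_sub₂, ← hz, UL, Q.isMorita.linner_lact, UL, P.isMorita.linner_lact, sub_self]
  · rw [← sub_eq_zero]
    apply Q.isMorita.eq_zero_of_rinner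
    change Q.data.rinner (U (P.data.ract a x) - Q.data.ract a (U x))
      (U (P.data.ract a x) - Q.data.ract a (U x)) = 0
    obtain ⟨z, hz⟩ := U.surjective (U (P.data.ract a x) - Q.data.ract a (U x))
    rw [map_sub, ← hz, UR, Q.isMorita.rinner_ract, UR, P.isMorita.rinner_ract, sub_self]

theorem Equivalent.refl (P : MoritaBimodule A) : P.Equivalent P :=
  ⟨LinearEquiv.refl ℂ _, by simp, by simp, by simp, by simp⟩

theorem Equivalent.symm {P Q : MoritaBimodule A} : P.Equivalent Q → Q.Equivalent P := by
  rintro ⟨U, h1, h2, h3, h4⟩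
  refine ⟨U.symm, fun a x => ?_, fun a x => ?_, fun x y => ?_, fun x y => ?_⟩
  · rw [LinearEquiv.symm_apply_eq, h1, LinearEquiv.apply_symm_apply]
  · rw [LinearEquiv.symm_apply_eq, h2, LinearEquiv.apply_symm_apply]
  · rw [← h3, LinearEquiv.apply_symm_apply, LinearEquiv.apply_symm_apply]
  · rw [← h4, LinearEquiv.apply_symm_apply, LinearEquiv.apply_symm_apply]

theorem Equivalent.trans {P Q R : MoritaBimodule A} :
    P.Equivalent Q → Q.Equivalent R → P.Equivalent R := by
  rintro ⟨U, h1, h2, h3, h4⟩ ⟨U', h1', h2', h3', h4'⟩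
  exact ⟨U.trans U', by simp [h1, h1'], by simp [h2, h2'], by simp [h3, h3'], by simp [h4, h4']⟩

instance setoid (A : Type u) [NonUnitalCStarAlgebra A] : Setoid (MoritaBimodule A) :=
  ⟨Equivalent, Equivalent.refl, Equivalent.symm, Equivalent.trans⟩

theorem tensor_congr {P P' Q Q' : MoritaBimodule A} (h : P.Equivalent P') (h' : Q.Equivalent Q') :
    (P.tensor Q).Equivalent (P'.tensor Q') := by
  obtain ⟨U, h1, h2, h3, h4⟩ := h
  obtain ⟨U', h1', h2', h3', h4'⟩ := h'
  refine equivalent_of_generators (fun p : P.carrier × Q.carrier => P.tmul Q p.1 p.2)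
    (fun p => P'.tmul Q' (U p.1) (U' p.2)) ?_ ?_ ?_ ?_
  · exact eq_top_of_tmul_mem _ _ _ (Submodule.isClosed_topologicalClosure _) fun x y =>
      Submodule.le_topologicalClosure _ (Submodule.subset_span ⟨(x, y), rfl⟩)
  · exact eq_top_of_tmul_mem _ _ _ (Submodule.isClosed_topologicalClosure _) fun x y =>
      Submodule.le_topologicalClosure _ (Submodule.subset_span ⟨(U.symm x, U'.symm y), by simp⟩)
  · intro i j
    simp only [tmul_linner, h3', ← h2, h3]
  · intro i j
    simp only [tmul_rinner, h4, ← h1', h4']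

theorem inv_congr {P Q : MoritaBimodule A} (h : P.Equivalent Q) : P.inv.Equivalent Q.inv := by
  obtain ⟨U, h1, h2, h3, h4⟩ := h
  exact ⟨{ toFun := U, invFun := U.symm, left_inv := U.left_inv, right_inv := U.right_inv
           map_add' := U.map_add
           map_smul' := fun c x => U.map_smul (star c) x },
    fun a x => h2 (star a) x, fun a x => h1 (star a) x, h4, h3⟩

theorem tensor_assoc (P Q R : MoritaBimodule A) :
    ((P.tensor Q).tensor R).Equivalent (P.tensor (Q.tensor R)) := by
  refine equivalent_of_generators
    (fun p : P.carrier × Q.carrier × R.carrier =>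
      (P.tensor Q).tmul R (P.tmul Q p.1 p.2.1) p.2.2)
    (fun p => P.tmul (Q.tensor R) p.1 (Q.tmul R p.2.1 p.2.2)) ?_ ?_ ?_ ?_
  · set S := (Submodule.span ℂ (Set.range fun p : P.carrier × Q.carrier × R.carrier =>
      (P.tensor Q).tmul R (P.tmul Q p.1 p.2.1) p.2.2)).topologicalClosure
    have hS : IsClosed (S : Set ((P.tensor Q).tensor R).carrier) := Submodule.isClosed_topologicalClosure _
    refine eq_top_of_tmul_mem _ _ _ hS fun x y => ?_
    have := eq_top_of_tmul_mem P Q (S.comap (((P.tensor Q).tmul R).flip y))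
      (hS.preimage ((P.tensor Q).continuous_tmul_left R y)) fun a b =>
        Submodule.le_topologicalClosure _ (Submodule.subset_span ⟨(a, b, y), rfl⟩)
    have hx : x ∈ S.comap (((P.tensor Q).tmul R).flip y) := by rw [this]; trivial
    exact hx
  · set S := (Submodule.span ℂ (Set.range fun p : P.carrier × Q.carrier × R.carrier =>
      P.tmul (Q.tensor R) p.1 (Q.tmul R p.2.1 p.2.2))).topologicalClosure
    have hS : IsClosed (S : Set (P.tensor (Q.tensor R)).carrier) := Submodule.isClosed_topologicalClosure _
    refine eq_top_of_tmul_mem _ _ _ hS fun x y => ?_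
    have := eq_top_of_tmul_mem Q R (S.comap (P.tmul (Q.tensor R) x))
      (hS.preimage (P.continuous_tmul_right (Q.tensor R) x)) fun a b =>
        Submodule.le_topologicalClosure _ (Submodule.subset_span ⟨(x, a, b), rfl⟩)
    have hy : y ∈ S.comap (P.tmul (Q.tensor R) x) := by rw [this]; trivial
    exact hy
  · intro i j
    simp only [tmul_linner, tmul_ract, Q.isMorita.linner_ract]
  · intro i j
    simp only [tmul_rinner, tmul_lact]

theorem one_tensor (P : MoritaBimodule A) : ((one A).tensor P).Equivalent P := by
  refine equivalent_of_generators (fun p : A × P.carrier => (one A).tmul P p.1 p.2)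
    (fun p => P.data.lact p.1 p.2) ?_ ?_ ?_ ?_
  · exact eq_top_of_tmul_mem _ _ _ (Submodule.isClosed_topologicalClosure _) fun x y =>
      Submodule.le_topologicalClosure _ (Submodule.subset_span ⟨(x, y), rfl⟩)
  · set S := (Submodule.span ℂ (Set.range fun p : A × P.carrier =>
      P.data.lact p.1 p.2)).topologicalClosure
    have hS : IsClosed (S : Set P.carrier) := Submodule.isClosed_topologicalClosure _
    rw [eq_top_iff]
    rintro x -
    obtain ⟨a, ha⟩ := P.isMorita.exists_tendsto x
    exact hS.mem_of_tendsto ha (Filter.Eventually.of_forall fun k =>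
      Submodule.le_topologicalClosure _ (Submodule.subset_span ⟨(a k, x), rfl⟩))
  · rintro ⟨a, x⟩ ⟨b, y⟩
    refine Eq.trans ?_ (tmul_linner (one A) P a b x y).symm
    change P.data.linner (P.data.lact a x) (P.data.lact b y) = a * P.data.linner x y * star b
    rw [P.isMorita.linner_lact, P.isMorita.isPre.linner_lact_right, ← mul_assoc]
  · rintro ⟨a, x⟩ ⟨b, y⟩
    refine Eq.trans ?_ (tmul_rinner (one A) P a b x y).symm
    change P.data.rinner (P.data.lact a x) (P.data.lact b y) =
      P.data.rinner x (P.data.lact (star a * b) y)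
    rw [P.isMorita.rinner_lact, ← P.isMorita.lact_mul]

theorem inv_tensor (P : MoritaBimodule A) : (P.inv.tensor P).Equivalent (one A) := by
  refine equivalent_of_generators (fun p : P.carrier × P.carrier => P.inv.tmul P p.1 p.2)
    (fun p => (P.data.rinner p.1 p.2 : A)) ?_ ?_ ?_ ?_
  · exact eq_top_of_tmul_mem _ _ _ (Submodule.isClosed_topologicalClosure _) fun x y =>
      Submodule.le_topologicalClosure _ (Submodule.subset_span ⟨(x, y), rfl⟩)
  · refine Eq.trans ?_ P.isMorita.rinner_full
    congr 2
    ext a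
    exact ⟨fun ⟨p, hp⟩ => ⟨p.1, p.2, hp⟩, fun ⟨x, y, h⟩ => ⟨(x, y), h⟩⟩
  · rintro ⟨x, y⟩ ⟨x', y'⟩
    refine Eq.trans ?_ (tmul_linner P.inv P x x' y y').symm
    change P.data.rinner x y * star (P.data.rinner x' y') =
      P.data.rinner (P.data.lact (star (P.data.linner y y')) x) x'
    rw [P.isMorita.rinner_lact, star_star, P.isMorita.imprimitivity, P.isMorita.rinner_ract,
      P.isMorita.star_rinner]
  · rintro ⟨x, y⟩ ⟨x', y'⟩
    refine Eq.trans ?_ (tmul_rinner P.inv P x x' y y').symm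
    change star (P.data.rinner x y) * P.data.rinner x' y' =
      P.data.rinner y (P.data.lact (P.data.linner x x') y')
    rw [P.isMorita.imprimitivity, P.isMorita.rinner_ract, P.isMorita.star_rinner]

end MoritaBimodule

/-- The Picard group of a C⋆-algebra: isomorphism classes of Morita equivalence bimodules. -/
def PicardGroup (A : Type u) [NonUnitalCStarAlgebra A] : Type (u + 1) :=
  Quotient (MoritaBimodule.setoid A)

/-- The class `[P]` in the Picard group. -/
def PicardGroup.mk {A : Type u} [NonUnitalCStarAlgebra A] (P : MoritaBimodule A) : PicardGroup A :=
  Quotient.mk _ P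

/-- The group structure: `[P] [Q] = [P ⊗_A Q]`, `1 = [A]`, and `[P]⁻¹` is the class of the
conjugate bimodule. -/
instance PicardGroup.group (A : Type u) [NonUnitalCStarAlgebra A] : Group (PicardGroup A) :=
  letI : Mul (PicardGroup A) :=
    ⟨Quotient.map₂ MoritaBimodule.tensor fun _ _ h _ _ h' => MoritaBimodule.tensor_congr h h'⟩
  letI : One (PicardGroup A) := ⟨PicardGroup.mk (MoritaBimodule.one A)⟩
  letI : Inv (PicardGroup A) :=
    ⟨Quotient.map MoritaBimodule.inv fun _ _ h => MoritaBimodule.inv_congr h⟩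
  Group.ofLeftAxioms
    (by
      rintro ⟨P⟩ ⟨Q⟩ ⟨R⟩
      exact Quotient.sound (MoritaBimodule.tensor_assoc P Q R))
    (by
      rintro ⟨P⟩
      exact Quotient.sound (MoritaBimodule.one_tensor P))
    (by
      rintro ⟨P⟩
      exact Quotient.sound (MoritaBimodule.inv_tensor P))

end Bimodules

/-- The fibre of `π : 𝓑 → X` over `x`. -/
@[ext]
structure Fiber {X : Type u} {𝓑 : Type v} (π : 𝓑 → X) (x : X) where
  val : 𝓑
  proj_eq : π val = x

/-- An element of the total space as an element of its own fibre. -/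
def toFiber {X : Type u} {𝓑 : Type v} (π : 𝓑 → X) (s : 𝓑) : Fiber π (π s) := ⟨s, rfl⟩

/-- A Banach bundle over `X` with total space `𝓑`; all topological spaces are Hausdorff, and the
base is locally compact. -/
class BanachBundle {X : Type u} {𝓑 : Type v} [TopologicalSpace X] [T2Space X]
    [LocallyCompactSpace X] [TopologicalSpace 𝓑] [T2Space 𝓑] (π : 𝓑 → X) where
  [normed (x : X) : NormedAddCommGroup (Fiber π x)]
  [space (x : X) : NormedSpace ℂ (Fiber π x)]
  [complete (x : X) : CompleteSpace (Fiber π x)]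
  continuous_proj : Continuous π
  isOpenMap_proj : IsOpenMap π
  surjective_proj : Function.Surjective π
  continuous_norm : Continuous fun s : 𝓑 => ‖toFiber π s‖
  continuous_add : Continuous fun p : {p : 𝓑 × 𝓑 // π p.1 = π p.2} =>
    ((⟨p.1.1, p.2⟩ : Fiber π (π p.1.2)) + toFiber π p.1.2).val
  continuous_smul (c : ℂ) : Continuous fun s : 𝓑 => (c • toFiber π s).val
  tendsto_zero (x : X) (l : Filter 𝓑) : Filter.Tendsto (fun s => ‖toFiber π s‖) l (𝓝 0) →
    Filter.Tendsto π l (𝓝 x) → l ≤ 𝓝 (0 : Fiber π x).val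

attribute [reducible] BanachBundle.normed BanachBundle.space
attribute [instance] BanachBundle.normed BanachBundle.space BanachBundle.complete

/-- The part of the definition of a Fell bundle over `G` that makes the unit fibre a C⋆-algebra:
a Banach bundle with a continuous associative multiplication and a continuous involution with
`(s t)⋆ = t⋆ s⋆` that are fibrewise (conjugate) linear over the operations of `G`, submultiplicative
and satisfy the C⋆-identity. -/
class PreFellBundle {G : Type u} {𝓑 : Type v} [Group G] [TopologicalSpace G] [T2Space G]
    [LocallyCompactSpace G] [TopologicalSpace 𝓑] [T2Space 𝓑] [Semigroup 𝓑] [StarMul 𝓑]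
    (π : 𝓑 → G) extends BanachBundle π where
  continuous_mul : Continuous fun p : 𝓑 × 𝓑 => p.1 * p.2
  continuous_star : Continuous fun s : 𝓑 => star s
  mul_bilinear (g h : G) : ∃ m : Fiber π g →ₗ[ℂ] Fiber π h →ₗ[ℂ] Fiber π (g * h),
    ∀ s t, (m s t).val = s.val * t.val
  norm_mul_le (s t : 𝓑) : ‖toFiber π (s * t)‖ ≤ ‖toFiber π s‖ * ‖toFiber π t‖
  star_antilinear (g : G) : ∃ j : Fiber π g →ₗ⋆[ℂ] Fiber π g⁻¹, ∀ s, (j s).val = star s.val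
  norm_star_mul_self (s : 𝓑) : ‖toFiber π (star s * s)‖ = ‖toFiber π s‖ ^ 2

section Fell

variable {G : Type u} {𝓑 : Type v} [Group G] [TopologicalSpace G] [T2Space G]
  [LocallyCompactSpace G] [TopologicalSpace 𝓑] [T2Space 𝓑] [Semigroup 𝓑] [StarMul 𝓑]

namespace PreFellBundle

variable (π : 𝓑 → G) [PreFellBundle π]

theorem proj_mul (s t : 𝓑) : π (s * t) = π s * π t := by
  obtain ⟨m, hm⟩ := mul_bilinear (π := π) (π s) (π t)
  have := (m (toFiber π s) (toFiber π t)).proj_eq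
  rwa [hm] at this

theorem proj_star (s : 𝓑) : π (star s) = (π s)⁻¹ := by
  obtain ⟨j, hj⟩ := star_antilinear (π := π) (π s)
  have := (j (toFiber π s)).proj_eq
  rwa [hj] at this

theorem norm_toFiber_val {g : G} (s : Fiber π g) : ‖toFiber π s.val‖ = ‖s‖ := by
  obtain ⟨s, rfl⟩ := s
  rfl

theorem exists_mulMap {g h k : G} (e : g * h = k) :
    ∃ m : Fiber π g →ₗ[ℂ] Fiber π h →ₗ[ℂ] Fiber π k, ∀ s t, (m s t).val = s.val * t.val := by
  subst e
  exact mul_bilinear g h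

theorem exists_starMap {g k : G} (e : g⁻¹ = k) :
    ∃ j : Fiber π g →ₗ⋆[ℂ] Fiber π k, ∀ s, (j s).val = star s.val := by
  subst e
  exact star_antilinear g

/-- The multiplication of the bundle, restricted to `B_g × B_h → B_k` where `g h = k`. -/
def mulMap {g h k : G} (e : g * h = k) : Fiber π g →ₗ[ℂ] Fiber π h →ₗ[ℂ] Fiber π k :=
  (exists_mulMap π e).choose

/-- The involution of the bundle, restricted to `B_g → B_k` where `g⁻¹ = k`. -/
def starMap {g k : G} (e : g⁻¹ = k) : Fiber π g →ₗ⋆[ℂ] Fiber π k := (exists_starMap π e).choose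

@[simp] theorem mulMap_val {g h k : G} (e : g * h = k) (s : Fiber π g) (t : Fiber π h) :
    (mulMap π e s t).val = s.val * t.val := (exists_mulMap π e).choose_spec s t

@[simp] theorem starMap_val {g k : G} (e : g⁻¹ = k) (s : Fiber π g) :
    (starMap π e s).val = star s.val := (exists_starMap π e).choose_spec s

theorem norm_mulMap_le {g h k : G} (e : g * h = k) (s : Fiber π g) (t : Fiber π h) :
    ‖mulMap π e s t‖ ≤ ‖s‖ * ‖t‖ := by
  rw [← norm_toFiber_val, ← norm_toFiber_val π s, ← norm_toFiber_val π t, mulMap_val]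
  exact norm_mul_le _ _

theorem norm_mulMap_star {g h k : G} (e : g⁻¹ = h) (e' : h * g = k) (s : Fiber π g) :
    ‖mulMap π e' (starMap π e s) s‖ = ‖s‖ * ‖s‖ := by
  rw [← norm_toFiber_val, ← norm_toFiber_val π s, mulMap_val, starMap_val, norm_star_mul_self,
    pow_two]

/-- The unit fibre `B_e`, with the operations of the bundle, is a C⋆-algebra. -/
instance : NonUnitalCStarAlgebra (Fiber π (1 : G)) where
  __ := BanachBundle.normed (π := π) (1 : G)
  __ := BanachBundle.space (π := π) (1 : G)
  complete := (BanachBundle.complete (π := π) (1 : G)).complete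
  mul s t := mulMap π (one_mul 1) s t
  left_distrib s t t' := map_add (mulMap π (one_mul 1) s) t t'
  right_distrib s s' t := LinearMap.map_add₂ (mulMap π (one_mul 1)) s s' t
  zero_mul s := LinearMap.map_zero₂ (mulMap π (one_mul 1)) s
  mul_zero s := map_zero (mulMap π (one_mul 1) s)
  mul_assoc s t r := by
    apply Fiber.ext
    change (mulMap π (one_mul 1) (mulMap π (one_mul 1) s t) r).val =
      (mulMap π (one_mul 1) s (mulMap π (one_mul 1) t r)).val
    simp only [mulMap_val, mul_assoc]
  dist_eq := NormedAddCommGroup.dist_eq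
  norm_mul_le s t := norm_mulMap_le π (one_mul 1) s t
  star s := starMap π inv_one s
  star_involutive s := by
    apply Fiber.ext
    change (starMap π inv_one (starMap π inv_one s)).val = s.val
    simp only [starMap_val, star_star]
  star_mul s t := by
    apply Fiber.ext
    change (starMap π inv_one (mulMap π (one_mul 1) s t)).val =
      (mulMap π (one_mul 1) (starMap π inv_one t) (starMap π inv_one s)).val
    simp only [mulMap_val, starMap_val, star_mul]
  star_add s t := map_add (starMap π inv_one) s t
  norm_mul_self_le s := (norm_mulMap_star π inv_one (one_mul 1) s).ge
  norm_smul_le c s := norm_smul_le c s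
  smul_assoc c s t := LinearMap.map_smul₂ (mulMap π (one_mul 1)) c s t
  smul_comm c s t := (map_smul (mulMap π (one_mul 1) s) c t).symm
  star_smul c s := map_smulₛₗ (starMap π inv_one) c s

/-- The fibre `B_g` with the actions `a s` and `s a` of `B_e` and the inner products `s t⋆` on the
left and `s⋆ t` on the right. -/
def fiberData (g : G) : BimoduleData (Fiber π (1 : G)) (Fiber π g) where
  lact := mulMap π (one_mul g)
  ract := (mulMap π (mul_one g)).flip
  linner := LinearMap.mk₂'ₛₗ (RingHom.id ℂ) (starRingEnd ℂ)
    (fun s t => mulMap π (mul_inv_cancel g) s (starMap π rfl t))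
    (by intros; simp) (by intros; simp) (by intros; simp) (by intros; simp)
  rinner := LinearMap.mk₂'ₛₗ (starRingEnd ℂ) (RingHom.id ℂ)
    (fun s t => mulMap π (inv_mul_cancel g) (starMap π rfl s) t)
    (by intros; simp) (by intros; simp) (by intros; simp) (by intros; simp)

end PreFellBundle

section

attribute [local instance] CStarAlgebra.spectralOrder

/-- A Fell bundle: in addition, `s⋆ s` is a positive element of the C⋆-algebra `B_e` for every `s`
in the bundle. -/
class FellBundle (π : 𝓑 → G) extends PreFellBundle π where
  star_mul_self_nonneg (g : G) (s : Fiber π g) :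
    0 ≤ PreFellBundle.mulMap π (inv_mul_cancel g) (PreFellBundle.starMap π rfl s) s

end

/-- A Fell bundle is saturated if the span of `B_g B_h` is dense in `B_{gh}` for all `g`, `h`. -/
def FellBundle.IsSaturated (π : 𝓑 → G) [FellBundle π] : Prop :=
  ∀ g h : G, (Submodule.span ℂ {r : Fiber π (g * h) |
    ∃ (s : Fiber π g) (t : Fiber π h), r.val = s.val * t.val}).topologicalClosure = ⊤

end Fell

end

/-! Every law of an imprimitivity bimodule, read in a fibre, is a law of the involutive semigroup
`𝓑` or an axiom of the bundle. The imprimitivity relation `(x y⋆) z = x (y⋆ z)` is associativity,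
and adjointability of the actions is associativity together with `(s t)⋆ = t⋆ s⋆`. Completeness
belongs to the Banach bundle. Positivity of `x⋆ x` is the Fell axiom at `x`, and positivity of `x
x⋆` is the same axiom at `x⋆`. Saturation at the pairs `(g⁻¹, g)` and `(g, g⁻¹)` says that the right
and the left inner product are full. One analytic point remains: the norm of the fibre must come
from both inner products, whereas the axioms give only `‖s⋆ s‖ = ‖s‖²`. The other identity follows
because the involution is isometric (`norm_mulMap_star_self`). Together these facts give
`IsSaturated.isMorita_fiberData`.

The homomorphism property amounts to `B_g ⊗ B_h ≅ B_{gh}` through `s ⊗ t ↦ s t`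
(`IsSaturated.tensor_fiberBimodule`). Elementary tensors generate the internal tensor product by
construction, and products generate `B_{gh}` by saturation. The two generating families, both
indexed by `B_g × B_h`, have the same inner products: `(s t)(s' t')⋆ = (s (t t'⋆)) s'⋆` and `(s t)⋆
(s' t') = t⋆ ((s⋆ s') t')`. Then `MoritaBimodule.equivalent_of_generators` provides the isomorphism.
It supplies well-definedness and surjectivity, and it also supplies compatibility with the actions,
since a Morita bimodule's actions are determined by its inner products.

A recurring formal issue is that `g * g⁻¹` and `1`, or `g⁻¹⁻¹` and `g`, are equal without being
definitionally equal, so the corresponding fibres are different types. The remedy is to let the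
target index of a product or an adjoint be free, subject to an equation, and to compare elements of
fibres by their values in `𝓑`. -/

namespace PreFellBundle

/-! ### The second C⋆-identity `‖s s⋆‖ = ‖s‖²` -/

variable {G : Type u} {𝓑 : Type v} [Group G] [TopologicalSpace G] [T2Space G]
  [LocallyCompactSpace G] [TopologicalSpace 𝓑] [T2Space 𝓑] [Semigroup 𝓑] [StarMul 𝓑]
  (π : 𝓑 → G) [PreFellBundle π]

/-- The axiom, applied to `s⋆`, gives `‖s⋆⋆ s⋆‖ = ‖s⋆‖²`, so it suffices that the involution is
isometric. This is the usual C⋆-algebra argument, carried out between different fibres. It makes the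
left inner product induce the norm of the fibre. -/
theorem norm_mulMap_star_self {g h k : G} (e : g * h = k) (e' : g⁻¹ = h) (s : Fiber π g) :
    ‖mulMap π e s (starMap π e' s)‖ = ‖s‖ ^ 2 := by
  -- From `‖t‖² = ‖t⋆ t‖ ≤ ‖t⋆‖ ‖t‖`, cancel `‖t‖` when it is nonzero. The claim is made for all
  -- indices because it is used twice, at `s` and at `s⋆`, which lie over different points.
  have le_norm_star : ∀ {a b : G} (e₀ : a⁻¹ = b) (t : Fiber π a), ‖t‖ ≤ ‖starMap π e₀ t‖ := by
    intro a b e₀ t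
    rcases (norm_nonneg t).eq_or_lt with h0 | h0
    · rw [← h0]; exact norm_nonneg _
    · refine le_of_mul_le_mul_right ?_ h0
      rw [← norm_mulMap_star π e₀ (rfl : b * a = b * a) t]
      exact norm_mulMap_le π _ _ _
  have hinv : h⁻¹ = g := by rw [← e', inv_inv]
  -- The second adjoint is sent back to the fibre over `g` itself by `hinv`, not to the one over
  -- `g⁻¹⁻¹`; only so can `s⋆⋆ = s` be stated without a cast.
  have hss : starMap π hinv (starMap π e' s) = s := Fiber.ext (by simp)
  have hn : ‖starMap π e' s‖ = ‖s‖ := by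
    refine le_antisymm ?_ (le_norm_star e' s)
    simpa only [hss] using le_norm_star hinv (starMap π e' s)
  have := norm_mulMap_star π hinv e (starMap π e' s)
  rwa [hss, hn, ← pow_two] at this

/-! ### Fibre operations computed in the total space -/

section val

variable (g : G) (a b : Fiber π (1 : G)) (s t : Fiber π g)

/-- This and the next five lemmas translate the C⋆-algebra and bimodule operations into the product
and involution of `𝓑`. After `Fiber.ext`, rewriting with them turns an algebraic identity between
fibre elements into one that `mul_assoc`, `star_mul` and `star_star` settle. -/
theorem mul_val : (a * b).val = a.val * b.val := mulMap_val π _ a b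

theorem star_val : (star a).val = star a.val := starMap_val π _ a

theorem fiberData_lact_val : ((fiberData π g).lact a s).val = a.val * s.val :=
  mulMap_val π (one_mul g) a s

theorem fiberData_ract_val : ((fiberData π g).ract a s).val = s.val * a.val :=
  mulMap_val π (mul_one g) s a

theorem fiberData_linner_val : ((fiberData π g).linner s t).val = s.val * star t.val :=
  (mulMap_val π _ s _).trans (by rw [starMap_val])

theorem fiberData_rinner_val : ((fiberData π g).rinner s t).val = star s.val * t.val :=
  (mulMap_val π _ _ t).trans (by rw [starMap_val])

end val

end PreFellBundle

/-! ### Each fibre is a Morita equivalence bimodule -/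

namespace FellBundle

open PreFellBundle

variable {G : Type u} {𝓑 : Type v} [Group G] [TopologicalSpace G] [T2Space G]
  [LocallyCompactSpace G] [TopologicalSpace 𝓑] [T2Space 𝓑] [Semigroup 𝓑] [StarMul 𝓑]
  {π : 𝓑 → G} [FellBundle π]

/-- With `k` free, saturation at `(g, g⁻¹)` and at `(g⁻¹, g)` can be read directly as density in the
unit fibre. -/
theorem IsSaturated.closure_span_mul (hsat : IsSaturated π) {g h k : G} (e : g * h = k) :
    (Submodule.span ℂ {r : Fiber π k |
      ∃ (s : Fiber π g) (t : Fiber π h), r.val = s.val * t.val}).topologicalClosure = ⊤ := by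
  subst e
  exact hsat g h

/-- The purely algebraic fields are instances of associativity and of the rules for the involution.
The remaining ones use positivity, saturation, the two C⋆-identities and completeness of the fibre.
-/
theorem IsSaturated.isMorita_fiberData (hsat : IsSaturated π) (g : G) :
    (fiberData π g).IsMorita where
  lact_mul a b x := Fiber.ext (by simp only [fiberData_lact_val, mul_val, mul_assoc])
  ract_mul a b x := Fiber.ext (by simp only [fiberData_ract_val, mul_val, mul_assoc])
  lact_ract a b x := Fiber.ext (by simp only [fiberData_lact_val, fiberData_ract_val, mul_assoc])
  linner_lact a x y := Fiber.ext (by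
    simp only [fiberData_lact_val, fiberData_linner_val, mul_val, mul_assoc])
  rinner_ract a x y := Fiber.ext (by
    simp only [fiberData_ract_val, fiberData_rinner_val, mul_val, mul_assoc])
  star_linner x y := Fiber.ext (by
    simp only [star_val, fiberData_linner_val, star_mul, star_star])
  star_rinner x y := Fiber.ext (by
    simp only [star_val, fiberData_rinner_val, star_mul, star_star])
  linner_nonneg x := by
    -- Positivity of `x x⋆` is the axiom for `x⋆` in `B_{g⁻¹}`, as `x⋆⋆ x⋆ = x x⋆`. Here `x⋆⋆`
    -- formally lies over `g⁻¹⁻¹`, so the two products are identified through their values in `𝓑`.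
    have h := star_mul_self_nonneg (π := π) g⁻¹ (starMap π rfl x)
    have e : mulMap π (inv_mul_cancel g⁻¹) (starMap π rfl (starMap π rfl x)) (starMap π rfl x) =
        (fiberData π g).linner x x := Fiber.ext (by
      simp only [mulMap_val, starMap_val, star_star, fiberData_linner_val])
    rwa [e] at h
  rinner_nonneg x := star_mul_self_nonneg (π := π) g x
  linner_ract a x y := Fiber.ext (by
    simp only [fiberData_ract_val, fiberData_linner_val, star_val, star_mul, star_star, mul_assoc])
  rinner_lact a x y := Fiber.ext (by
    simp only [fiberData_lact_val, fiberData_rinner_val, star_val, star_mul, mul_assoc])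
  imprimitivity x y z := Fiber.ext (by
    simp only [fiberData_lact_val, fiberData_ract_val, fiberData_linner_val, fiberData_rinner_val,
      mul_assoc])
  linner_full := by
    rw [eq_top_iff]
    refine (hsat.closure_span_mul (mul_inv_cancel g)).ge.trans ?_
    refine Submodule.topologicalClosure_mono (Submodule.span_mono ?_)
    rintro r ⟨s, t, hr⟩
    -- A product `s t` with `t` in `B_{g⁻¹}` is the left inner product of `s` and `t⋆`, and `t⋆`
    -- lies in `B_g`.
    refine ⟨s, starMap π (inv_inv g) t, Fiber.ext ?_⟩
    rw [hr, fiberData_linner_val, starMap_val, star_star]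
  rinner_full := by
    rw [eq_top_iff]
    refine (hsat.closure_span_mul (inv_mul_cancel g)).ge.trans ?_
    refine Submodule.topologicalClosure_mono (Submodule.span_mono ?_)
    rintro r ⟨s, t, hr⟩
    -- Symmetrically, `s` in `B_{g⁻¹}` is the adjoint of `s⋆` in `B_g`, so `s t` is the right inner
    -- product of `s⋆` and `t`.
    refine ⟨starMap π (inv_inv g) s, t, Fiber.ext ?_⟩
    rw [hr, fiberData_rinner_val, starMap_val, star_star]
  norm_sq_linner x := (norm_mulMap_star_self π (mul_inv_cancel g) rfl x).symm
  norm_sq_rinner x := (pow_two ‖x‖).trans (norm_mulMap_star π rfl (inv_mul_cancel g) x).symm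
  complete := BanachBundle.complete g

/-- The fibre `B_g` of a saturated Fell bundle as a Morita equivalence bimodule. -/
noncomputable def IsSaturated.fiberBimodule (hsat : IsSaturated π) (g : G) : MoritaBimodule (Fiber π (1 : G)) :=
  ⟨Fiber π g, fiberData π g, hsat.isMorita_fiberData g⟩

/-! ### Tensor products of fibres and the homomorphism to the Picard group -/

/-- The multiplication of a saturated Fell bundle induces an isomorphism `B_g ⊗ B_h ≅ B_{gh}`. -/
theorem IsSaturated.tensor_fiberBimodule (hsat : IsSaturated π) (g h : G) :
    ((hsat.fiberBimodule g).tensor (hsat.fiberBimodule h)).Equivalent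
      (hsat.fiberBimodule (g * h)) := by
  -- The pair `(s, t)` indexes `s ⊗ t` on one side and `s t` on the other. No map out of the
  -- completed tensor product has to be built by hand: equality of the inner products makes the
  -- correspondence isometric on linear combinations.
  refine MoritaBimodule.equivalent_of_generators
    (fun p : Fiber π g × Fiber π h =>
      (hsat.fiberBimodule g).tmul (hsat.fiberBimodule h) p.1 p.2)
    (fun p => mulMap π (rfl : g * h = g * h) p.1 p.2) ?_ ?_ ?_ ?_
  · exact MoritaBimodule.eq_top_of_tmul_mem _ _ _ (Submodule.isClosed_topologicalClosure _)
      fun x y => Submodule.le_topologicalClosure _ (Submodule.subset_span ⟨(x, y), rfl⟩)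
  -- Density of the span of the products `s t` is saturation at `(g, h)`; only the two descriptions
  -- of the set of products have to be matched.
  · refine Eq.trans ?_ (hsat.closure_span_mul (rfl : g * h = g * h))
    congr 2
    ext r
    constructor
    · rintro ⟨p, rfl⟩
      exact ⟨p.1, p.2, mulMap_val π _ _ _⟩
    · rintro ⟨s, t, hr⟩
      exact ⟨(s, t), Fiber.ext ((mulMap_val π _ s t).trans hr.symm)⟩
  · rintro ⟨s, t⟩ ⟨s', t'⟩
    refine Eq.trans (Fiber.ext ?_) (MoritaBimodule.tmul_linner (hsat.fiberBimodule g)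
      (hsat.fiberBimodule h) s s' t t').symm
    -- Unfolding the bundled bimodules exposes `fiberData`, to which the value lemmas apply. Both
    -- sides then become the word `s t t'⋆ s'⋆` in `𝓑`.
    change ((fiberData π (g * h)).linner (mulMap π rfl s t) (mulMap π rfl s' t')).val =
      ((fiberData π g).linner ((fiberData π g).ract ((fiberData π h).linner t t') s) s').val
    simp only [fiberData_linner_val, fiberData_ract_val, mulMap_val, star_mul, mul_assoc]
  · rintro ⟨s, t⟩ ⟨s', t'⟩
    refine Eq.trans (Fiber.ext ?_) (MoritaBimodule.tmul_rinner (hsat.fiberBimodule g)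
      (hsat.fiberBimodule h) s s' t t').symm
    -- Here the common word is `t⋆ s⋆ s' t'`.
    change ((fiberData π (g * h)).rinner (mulMap π rfl s t) (mulMap π rfl s' t')).val =
      ((fiberData π h).rinner t ((fiberData π h).lact ((fiberData π g).rinner s s') t')).val
    simp only [fiberData_rinner_val, fiberData_lact_val, mulMap_val, star_mul, mul_assoc]

/-- The homomorphism `g ↦ [B_g]` from the base group to the Picard group of the unit fibre. -/
noncomputable def IsSaturated.toPicardGroup (hsat : IsSaturated π) : G →* PicardGroup (Fiber π (1 : G)) :=
  -- Between groups multiplicativity suffices, so `[B_e] = 1` needs no separate check. The product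
  -- of two classes reduces by definition to the class of the tensor product, hence the isomorphism
  -- `B_g ⊗ B_h ≅ B_{gh}` is exactly what is required.
  MonoidHom.mk' (fun g => PicardGroup.mk (hsat.fiberBimodule g)) fun g h =>
    (Quotient.sound (hsat.tensor_fiberBimodule g h)).symm

end FellBundle

/-- The Morita property is asserted before `ψ` because the class `[B_g]` can only be formed from a
proof of it. The formula for `ψ` then holds by definition of `toPicardGroup`. -/
theorem mainTheorem7 {G : Type u} {𝓑 : Type v} [Group G] [TopologicalSpace G]
    [IsTopologicalGroup G] [T2Space G] [LocallyCompactSpace G] [TopologicalSpace 𝓑] [T2Space 𝓑]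
    [Semigroup 𝓑] [StarMul 𝓑] (π : 𝓑 → G) [FellBundle π] (hsat : FellBundle.IsSaturated π) :
    ∃ hM : ∀ g : G, (PreFellBundle.fiberData π g).IsMorita,
      ∃ ψ : G →* PicardGroup (Fiber π (1 : G)),
        ∀ g : G, ψ g =
          PicardGroup.mk ⟨Fiber π g, PreFellBundle.fiberData π g, hM g⟩ :=
  ⟨hsat.isMorita_fiberData, hsat.toPicardGroup, fun _ => rfl⟩
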